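/- Unoriented framed links in $S^3$ are presented by link diagrams in the square $I\times I$ with the blackboard framing; two diagrams present the same framed link if and only if they are related by planar isotopy, the framed first Reidemeister move (two curls of the same writhe on opposite sides of a strand are exchanged) and the second and third Reidemeister moves. Let $\mathcal{T}$ be the set of unoriented framed links, and let $\mathcal{S}$ be the Kauffman bracket skein module of $I\times I$: the quotient of the free $\mathbb{Q}[A,A^{-1}]$-module with basis $\mathcal{T}$ by the submodule generated by all $-T_1+A\,T_\infty+A^{-1}T_0$, where $T_1,T_\infty,T_0$ have diagrams that are identical except near one crossing of $T_1$, which is smoothed in $T_\infty$ by joining the two regions swept out when the over strand is turned counterclockwise, and in $T_0$ by joining the other two regions, and all $T\sqcup\mathcal{O}+(A^2+A^{-2})T$, where $\mathcal{O}$ is the trivial knot. Write $[L]$ for the class of $L$ in $\mathcal{S}$. For every framed link $L$ there is exactly one Laurent polynomial $\mathcal{K}(L)\in\mathbb{Q}[A,A^{-1}]$, the Kauffman bracket of $L$, with $[L]=\mathcal{K}(L)\,[\emptyset]$ in $\mathcal{S}$. Moreover, let $L$ be an unoriented framed link in $S^3$, let $m\ge 0$, let $K_1,\dots,K_m$ be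 distinct components of $L$, and let $L'=L\setminus\bigcup_{i=1}^m K_i$. Then $$\mathcal{K}\Big(L,\bigcup_{i=1}^m K_i\Big):=\sum_{S\subseteq\{1,\dots,m\}}2^{\,m-|S|}\,\mathcal{K}\Big(L'\cup\bigcup_{i\in S}K_i\Big)\in(A+1)^m\,\mathbb{Q}[A,A^{-1}].$$ -/

import Mathlib

open scoped LaurentPolynomial

namespace Skein

/-! ### Link diagrams in the square

A link diagram in the square is put in general position with respect to the height function and
cut into horizontal slices, each of which contains one local minimum (`cup`), one local maximum
(`cap`) or one crossing, and otherwise only vertical strands.  It is read from bottom to top. -/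

/-- The non-trivial piece of a slice.  In `cross true` the strand that runs from bottom left to
top right is the over strand; in `cross false` it is the under strand. -/
inductive Tile where
  | cup : Tile
  | cap : Tile
  | cross : Bool → Tile

/-- The number of strands that enter a piece from below. -/
def Tile.bot : Tile → ℕ
  | .cup => 0
  | .cap => 2
  | .cross _ => 2

/-- The number of strands that leave a piece at its top. -/
def Tile.top : Tile → ℕ
  | .cup => 2
  | .cap => 0
  | .cross _ => 2

/-- A slice: a piece with exactly `pos` vertical strands on its left. -/
structure Slice where
  tile : Tile
  pos : ℕ

/-- `IsTangle n w n'`: the slices `w`, stacked from bottom to top, form a diagram that is entered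
by `n` strands at the bottom and left by `n'` strands at the top. -/
inductive IsTangle : ℕ → List Slice → ℕ → Prop
  | nil (n : ℕ) : IsTangle n [] n
  | cons (τ : Tile) (i k : ℕ) (w : List Slice) (n : ℕ) :
      IsTangle (i + τ.top + k) w n → IsTangle (i + τ.bot + k) (⟨τ, i⟩ :: w) n

/-- A link diagram: a diagram without end points. -/
def LinkDiagram : Type := {w : List Slice // IsTangle 0 w 0}

/-- The empty diagram. -/
def LinkDiagram.empty : LinkDiagram := ⟨[], IsTangle.nil 0⟩

theorem IsTangle.append {n n' n'' : ℕ} {w w' : List Slice} (h : IsTangle n w n')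
    (h' : IsTangle n' w' n'') : IsTangle n (w ++ w') n'' := by
  induction h with
  | nil n => exact h'
  | cons τ i k w n _ ih => exact IsTangle.cons τ i k _ _ (ih h')

theorem isTangle_circle : IsTangle 0 [⟨.cup, 0⟩, ⟨.cap, 0⟩] 0 := by
  have h1 : IsTangle 2 [⟨.cap, 0⟩] 0 := IsTangle.cons .cap 0 0 [] 0 (IsTangle.nil 0)
  exact IsTangle.cons .cup 0 0 [⟨.cap, 0⟩] 0 h1

/-- The disjoint union of a diagram and a circle without crossings. -/
def LinkDiagram.addCircle (D : LinkDiagram) : LinkDiagram :=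
  ⟨D.1 ++ [⟨.cup, 0⟩, ⟨.cap, 0⟩],
    D.2.append isTangle_circle⟩

/-! ### Unoriented framed links -/

/-- The local moves between diagrams with the blackboard framing. -/
inductive Move : List Slice → List Slice → Prop
  /-- Planar isotopy: two pieces that lie side by side exchange their heights. -/
  | exchange (σ τ : Tile) (i k : ℕ) :
      Move [⟨σ, i⟩, ⟨τ, i + σ.top + k⟩] [⟨τ, i + σ.bot + k⟩, ⟨σ, i⟩]
  /-- Planar isotopy: a minimum and a neighbouring maximum cancel. -/
  | zigzag_left (i : ℕ) : Move [⟨.cup, i + 1⟩, ⟨.cap, i⟩] []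
  | zigzag_right (i : ℕ) : Move [⟨.cup, i⟩, ⟨.cap, i + 1⟩] []
  /-- Planar isotopy: a crossing is turned past a minimum or a maximum. -/
  | slide_cup (ε : Bool) (i : ℕ) :
      Move [⟨.cup, i⟩, ⟨.cross ε, i + 1⟩] [⟨.cup, i + 1⟩, ⟨.cross (!ε), i⟩]
  | slide_cap (ε : Bool) (i : ℕ) :
      Move [⟨.cross ε, i⟩, ⟨.cap, i + 1⟩] [⟨.cross (!ε), i + 1⟩, ⟨.cap, i⟩]
  /-- The framed first Reidemeister move: the curl on the right of a strand and the curl on its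
  left with the same writhe are exchanged. -/
  | reidemeister_one (ε : Bool) (i : ℕ) :
      Move [⟨.cup, i + 1⟩, ⟨.cross ε, i⟩, ⟨.cap, i + 1⟩]
        [⟨.cup, i⟩, ⟨.cross ε, i + 1⟩, ⟨.cap, i⟩]
  /-- The second Reidemeister move. -/
  | reidemeister_two (ε : Bool) (i : ℕ) : Move [⟨.cross ε, i⟩, ⟨.cross (!ε), i⟩] []
  /-- The third Reidemeister move. -/
  | reidemeister_three (ε : Bool) (i : ℕ) :
      Move [⟨.cross ε, i⟩, ⟨.cross ε, i + 1⟩, ⟨.cross ε, i⟩]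
        [⟨.cross ε, i + 1⟩, ⟨.cross ε, i⟩, ⟨.cross ε, i + 1⟩]

/-- Two link diagrams differ by one local move. -/
def LinkDiagram.Step (D D' : LinkDiagram) : Prop :=
  ∃ u v a b : List Slice, Move a b ∧ D.1 = u ++ a ++ v ∧ D'.1 = u ++ b ++ v

/-- Isotopy classes of unoriented framed links: link diagrams (with the blackboard framing) modulo
the equivalence relation generated by the local moves. -/
def FramedLink : Type := Quot LinkDiagram.Step

/-- The framed link that a diagram presents. -/
def LinkDiagram.toLink (D : LinkDiagram) : FramedLink := Quot.mk _ D

/-! ### Components and sublinks -/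

/-- `(t, j)` is a point of the diagram: the `j`-th strand (counted from `0`) is present between the
first `t` slices and the remaining ones. -/
def IsPoint (w : List Slice) (p : ℕ × ℕ) : Prop :=
  p.1 ≤ w.length ∧ ∃ n, IsTangle 0 (w.take p.1) n ∧ p.2 < n

/-- Two points are the two ends of an arc that lies in one slice. -/
inductive Joined (w : List Slice) : ℕ × ℕ → ℕ × ℕ → Prop
  | left (t j : ℕ) (s : Slice) : w[t]? = some s → j < s.pos → Joined w (t, j) (t + 1, j)
  | right (t k : ℕ) (s : Slice) : w[t]? = some s →
      Joined w (t, s.pos + s.tile.bot + k) (t + 1, s.pos + s.tile.top + k)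
  | cup (t i : ℕ) : w[t]? = some ⟨.cup, i⟩ → Joined w (t + 1, i) (t + 1, i + 1)
  | cap (t i : ℕ) : w[t]? = some ⟨.cap, i⟩ → Joined w (t, i) (t, i + 1)
  | cross_up (t i : ℕ) (ε : Bool) : w[t]? = some ⟨.cross ε, i⟩ → Joined w (t, i) (t + 1, i + 1)
  | cross_down (t i : ℕ) (ε : Bool) : w[t]? = some ⟨.cross ε, i⟩ → Joined w (t, i + 1) (t + 1, i)

/-- The points of a link diagram. -/
def LinkDiagram.Point (D : LinkDiagram) : Type := {p : ℕ × ℕ // IsPoint D.1 p}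

/-- The components of a link diagram: classes of points that are connected by arcs. -/
def LinkDiagram.Component (D : LinkDiagram) : Type :=
  Quot fun p q : D.Point => Joined D.1 p.1 q.1

/-- The point `(t, j)` exists and lies on one of the components in `S`. -/
def LinkDiagram.Kept (D : LinkDiagram) (S : Set D.Component) (t j : ℕ) : Prop :=
  ∃ p : D.Point, p.1 = (t, j) ∧ (Quot.mk _ p : D.Component) ∈ S

/-- The piece of a slice that begins at level `t` survives if all of its strands are kept. -/
def Slice.Survives (kept : ℕ → ℕ → Prop) (t : ℕ) (s : Slice) : Prop :=
  match s.tile with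
  | .cup => kept (t + 1) s.pos
  | .cap => kept t s.pos
  | .cross _ => kept t s.pos ∧ kept t (s.pos + 1)

/-- The number of kept points among the first `n` ones at level `t`. -/
noncomputable def keptCount (kept : ℕ → ℕ → Prop) (t n : ℕ) : ℕ := by
  classical exact ((Finset.range n).filter (kept t)).card

/-- Erase the strands that are not kept from a diagram that begins at level `t`. -/
noncomputable def eraseFrom (kept : ℕ → ℕ → Prop) : ℕ → List Slice → List Slice
  | _, [] => []
  | t, s :: w => by
      classical exact
        if s.Survives kept t then
          ⟨s.tile, keptCount kept t s.pos⟩ :: eraseFrom kept (t + 1) w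
        else eraseFrom kept (t + 1) w

/-- Whether a point is kept is constant along the arcs of a slice. -/
structure Compatible (kept : ℕ → ℕ → Prop) (t k : ℕ) (τ : Tile) (i : ℕ) : Prop where
  left : ∀ j < i, (kept t j ↔ kept (t + 1) j)
  right : ∀ j < k, (kept t (i + τ.bot + j) ↔ kept (t + 1) (i + τ.top + j))
  cup : τ = .cup → (kept (t + 1) i ↔ kept (t + 1) (i + 1))
  cap : τ = .cap → (kept t i ↔ kept t (i + 1))
  cross_up : ∀ ε, τ = .cross ε → (kept t i ↔ kept (t + 1) (i + 1))
  cross_down : ∀ ε, τ = .cross ε → (kept t (i + 1) ↔ kept (t + 1) i)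

theorem keptCount_succ (kept : ℕ → ℕ → Prop) (t n : ℕ) [Decidable (kept t n)] :
    keptCount kept t (n + 1) = keptCount kept t n + if kept t n then 1 else 0 := by
  classical
  unfold keptCount
  rw [Finset.range_add_one, Finset.filter_insert]
  split_ifs with h <;> simp

theorem keptCount_congr (kept : ℕ → ℕ → Prop) {t t' n : ℕ}
    (h : ∀ j < n, (kept t j ↔ kept t' j)) : keptCount kept t n = keptCount kept t' n := by
  classical
  unfold keptCount
  congr 1
  apply Finset.filter_congr
  intro j hj
  exact h j (Finset.mem_range.1 hj)

theorem keptCount_add_congr (kept : ℕ → ℕ → Prop) {t t' a a' k : ℕ}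
    (h : ∀ j < k, (kept t (a + j) ↔ kept t' (a' + j))) :
    ∃ c, keptCount kept t (a + k) = keptCount kept t a + c ∧
      keptCount kept t' (a' + k) = keptCount kept t' a' + c := by
  classical
  induction k with
  | zero => exact ⟨0, rfl, rfl⟩
  | succ k ih =>
    obtain ⟨c, h1, h2⟩ := ih fun j hj => h j (by omega)
    refine ⟨c + if kept t (a + k) then 1 else 0, ?_, ?_⟩
    · rw [← add_assoc, keptCount_succ, h1, add_assoc]
    · rw [← add_assoc, keptCount_succ, h2, add_assoc]
      simp only [h k (by omega)]

theorem IsTangle.eraseFrom {kept : ℕ → ℕ → Prop} {n n' : ℕ} {w : List Slice}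
    (h : IsTangle n w n') (t : ℕ)
    (hc : ∀ r i k τ, w[r]? = some ⟨τ, i⟩ → IsTangle n (w.take r) (i + τ.bot + k) →
      Compatible kept (t + r) k τ i) :
    IsTangle (keptCount kept t n) (Skein.eraseFrom kept t w)
      (keptCount kept (t + w.length) n') := by
  classical
  induction h generalizing t with
  | nil n => exact IsTangle.nil _
  | cons τ i k w n hw ih =>
    have hcomp := hc 0 i k τ rfl (IsTangle.nil _)
    have ih' := ih (t + 1) fun r i' k' τ' h1 h2 => by
      have := hc (r + 1) i' k' τ' (by simpa using h1)
        (by simpa using IsTangle.cons τ i k _ _ h2)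
      rwa [show t + (r + 1) = t + 1 + r by omega] at this
    rw [show t + 1 + w.length = t + (w.length + 1) by omega] at ih'
    obtain ⟨c, h1, h2⟩ := keptCount_add_congr kept hcomp.right
    have h0 := keptCount_congr kept hcomp.left
    simp only [add_zero] at h1 h2 h0 hcomp
    simp only [Skein.eraseFrom, List.length_cons, Slice.Survives]
    rw [h1]
    rw [h2] at ih'
    cases τ with
    | cup =>
      have e := hcomp.cup rfl
      simp only [Tile.top, Tile.bot, add_zero] at ih' ⊢
      rw [show i + 2 = i + 1 + 1 from rfl, keptCount_succ, keptCount_succ, ← h0] at ih'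
      by_cases hk : kept (t + 1) i
      · simp only [hk, e.1 hk, if_true] at ih' ⊢
        exact IsTangle.cons .cup _ c _ _ ih'
      · simp only [hk, e.not.1 hk, if_false] at ih' ⊢
        exact ih'
    | cap =>
      have e := hcomp.cap rfl
      simp only [Tile.top, Tile.bot, add_zero] at ih' ⊢
      rw [show i + 2 = i + 1 + 1 from rfl, keptCount_succ, keptCount_succ]
      rw [← h0] at ih'
      by_cases hk : kept t i
      · simp only [hk, e.1 hk, if_true]
        exact IsTangle.cons .cap _ c _ _ ih'
      · simp only [hk, e.not.1 hk, if_false]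
        exact ih'
    | cross ε =>
      have e1 := hcomp.cross_up ε rfl
      have e2 := hcomp.cross_down ε rfl
      simp only [Tile.top, Tile.bot] at ih' ⊢
      rw [show i + 2 = i + 1 + 1 from rfl, keptCount_succ, keptCount_succ]
      rw [show i + 2 = i + 1 + 1 from rfl, keptCount_succ, keptCount_succ, ← h0] at ih'
      simp only [← e1, ← e2] at ih'
      by_cases hk : kept t i <;> by_cases hk' : kept t (i + 1) <;>
        simp only [hk, hk', if_true, if_false, and_true, and_false, add_zero] at ih' ⊢
      · exact IsTangle.cons (.cross ε) _ c _ _ ih'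
      · exact ih'
      · exact ih'
      · exact ih'

theorem IsTangle.eq_of_eq {n n' n'' : ℕ} {w : List Slice} (h : IsTangle n w n')
    (h' : IsTangle n w n'') : n' = n'' := by
  induction h generalizing n'' with
  | nil n => cases h'; rfl
  | cons τ i k w n _ ih =>
    generalize hm : i + τ.bot + k = m at h'
    cases h' with
    | cons _ _ k' _ _ h' =>
      obtain rfl : k = k' := by omega
      exact ih h'

theorem IsTangle.take_succ {n m : ℕ} {w : List Slice} {r i k : ℕ} {τ : Tile}
    (h : IsTangle n (w.take r) m) (hr : w[r]? = some ⟨τ, i⟩) (hm : m = i + τ.bot + k) :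
    IsTangle n (w.take (r + 1)) (i + τ.top + k) := by
  subst hm
  rw [List.take_add_one, hr]
  exact h.append (IsTangle.cons τ i k _ _ (IsTangle.nil _))

theorem LinkDiagram.kept_iff (D : LinkDiagram) (S : Set D.Component) {p q : ℕ × ℕ}
    (hp : IsPoint D.1 p) (hq : IsPoint D.1 q) (h : Joined D.1 p q) :
    D.Kept S p.1 p.2 ↔ D.Kept S q.1 q.2 := by
  have e : (Quot.mk _ ⟨p, hp⟩ : D.Component) = Quot.mk _ ⟨q, hq⟩ := Quot.sound h
  constructor
  · rintro ⟨⟨_, hp'⟩, rfl, hS⟩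
    exact ⟨⟨q, hq⟩, rfl, by rwa [← e]⟩
  · rintro ⟨⟨_, hq'⟩, rfl, hS⟩
    exact ⟨⟨p, hp⟩, rfl, by rwa [e]⟩

theorem LinkDiagram.compatible (D : LinkDiagram) (S : Set D.Component) (r i k : ℕ) (τ : Tile)
    (hr : D.1[r]? = some ⟨τ, i⟩) (hw : IsTangle 0 (D.1.take r) (i + τ.bot + k)) :
    Compatible (D.Kept S) r k τ i := by
  have hlt : r < D.1.length := (List.getElem?_eq_some_iff.1 hr).1
  have hw' := hw.take_succ hr rfl
  have lo : ∀ j < i + τ.bot + k, IsPoint D.1 (r, j) := fun j hj => ⟨hlt.le, _, hw, hj⟩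
  have hi : ∀ j < i + τ.top + k, IsPoint D.1 (r + 1, j) := fun j hj => ⟨hlt, _, hw', hj⟩
  refine ⟨fun j hj => ?_, fun j hj => ?_, ?_, ?_, ?_, ?_⟩
  · exact D.kept_iff S (lo j (by omega)) (hi j (by omega)) (.left r j ⟨τ, i⟩ hr hj)
  · exact D.kept_iff S (lo _ (by omega)) (hi _ (by omega)) (.right r j ⟨τ, i⟩ hr)
  · rintro rfl
    exact D.kept_iff S (hi _ (by simp [Tile.top]; omega)) (hi _ (by simp [Tile.top]; omega))
      (.cup r i hr)
  · rintro rfl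
    exact D.kept_iff S (lo _ (by simp [Tile.bot]; omega)) (lo _ (by simp [Tile.bot]; omega))
      (.cap r i hr)
  · rintro ε rfl
    exact D.kept_iff S (lo _ (by simp [Tile.bot]; omega)) (hi _ (by simp [Tile.top]; omega))
      (.cross_up r i ε hr)
  · rintro ε rfl
    exact D.kept_iff S (lo _ (by simp [Tile.bot]; omega)) (hi _ (by simp [Tile.top]; omega))
      (.cross_down r i ε hr)

/-- The sublink that consists of the components in `S`: the other components are erased from the
diagram. -/
noncomputable def LinkDiagram.sublink (D : LinkDiagram) (S : Set D.Component) : LinkDiagram :=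
  ⟨eraseFrom (D.Kept S) 0 D.1, by
    have h := D.2.eraseFrom (kept := D.Kept S) 0 fun r i k τ h1 h2 => by
      simpa using D.compatible S r i k τ h1 h2
    simpa [keptCount] using h⟩

/-! ### The Kauffman bracket skein module of the square -/

/-- The indeterminate `A` of the ring of Laurent polynomials `ℚ[A, A⁻¹]`. -/
noncomputable def A : ℚ[T;T⁻¹] := LaurentPolynomial.T 1

/-- The inverse of the indeterminate. -/
noncomputable def Ainv : ℚ[T;T⁻¹] := LaurentPolynomial.T (-1)

/-- `T₁`, `T∞`, `T₀` are presented by diagrams that are identical except near one crossing of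
`T₁`, which is smoothed in the two possible ways.  The two regions that the over strand sweeps when
it is turned counterclockwise are joined in `T∞`, the other two in `T₀`. -/
def IsKauffmanTriple (T₁ Tinf T₀ : FramedLink) : Prop :=
  ∃ (D₁ Dinf D₀ : LinkDiagram) (u v : List Slice) (i : ℕ),
    D₁.toLink = T₁ ∧ Dinf.toLink = Tinf ∧ D₀.toLink = T₀ ∧
    ((D₁.1 = u ++ [⟨.cross true, i⟩] ++ v ∧
        Dinf.1 = u ++ v ∧ D₀.1 = u ++ [⟨.cap, i⟩, ⟨.cup, i⟩] ++ v) ∨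
      (D₁.1 = u ++ [⟨.cross false, i⟩] ++ v ∧
        Dinf.1 = u ++ [⟨.cap, i⟩, ⟨.cup, i⟩] ++ v ∧ D₀.1 = u ++ v))

/-- The submodule of skein relations `-T₁ + A T∞ + A⁻¹ T₀` and `(T ⊔ O) + (A² + A⁻²) T`, where `O`
is the trivial knot. -/
noncomputable def skeinRelations : Submodule ℚ[T;T⁻¹] (FramedLink →₀ ℚ[T;T⁻¹]) :=
  Submodule.span ℚ[T;T⁻¹]
    ({x | ∃ T₁ Tinf T₀ : FramedLink, IsKauffmanTriple T₁ Tinf T₀ ∧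
        x = -Finsupp.single T₁ 1 + A • Finsupp.single Tinf 1 + Ainv • Finsupp.single T₀ 1} ∪
      {x | ∃ D : LinkDiagram,
        x = Finsupp.single D.addCircle.toLink 1 +
          (A ^ 2 + Ainv ^ 2) • Finsupp.single D.toLink 1})

/-- The Kauffman bracket skein module of the square. -/
abbrev SkeinModule : Type := (FramedLink →₀ ℚ[T;T⁻¹]) ⧸ skeinRelations

/-- The element of the skein module that a framed link represents. -/
noncomputable def FramedLink.skein (L : FramedLink) : SkeinModule :=
  skeinRelations.mkQ (Finsupp.single L 1)

/-- The element of the skein module that the empty link represents. -/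
noncomputable def skeinEmpty : SkeinModule := LinkDiagram.empty.toLink.skein

/-- The Kauffman bracket `𝒦(L)`, defined by `[L] = 𝒦(L) [∅]` in the skein module. -/
noncomputable def kauffmanBracket (L : FramedLink) : ℚ[T;T⁻¹] :=
  Classical.epsilon fun p => L.skein = p • skeinEmpty

/-- For a link with components `K i`, `i < m`, chosen, the sublink `L' ∪ ⋃_{i ∈ S} K i`, where `L'`
consists of the components that are not chosen. -/
noncomputable def LinkDiagram.withChosen (D : LinkDiagram) {m : ℕ} (K : Fin m → D.Component)
    (S : Finset (Fin m)) : FramedLink :=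
  (D.sublink {c | ∀ i, c = K i → i ∈ S}).toLink

/-- The sum `𝒦(L, ⋃ K i) = ∑_S 2^(m - |S|) 𝒦(L' ∪ ⋃_{i ∈ S} K i)`. -/
noncomputable def LinkDiagram.cabledSum (D : LinkDiagram) {m : ℕ} (K : Fin m → D.Component) :
    ℚ[T;T⁻¹] :=
  ∑ S : Finset (Fin m), 2 ^ (m - S.card) * kauffmanBracket (D.withChosen K S)

end Skein

namespace Skein

/-! ### A state sum for the bracket -/

section StateSum

/-- Insert the colours `u`, `v` at the positions `i`, `i + 1`. -/
def ins (i : ℕ) (u v : Bool) (x : ℕ → Bool) : ℕ → Bool := fun j =>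
  if j < i then x j else if j = i then u else if j = i + 1 then v else x (j - 2)

/-- Delete the colours at the positions `i`, `i + 1`. -/
def del (i : ℕ) (x : ℕ → Bool) : ℕ → Bool := fun j => if j < i then x j else x (j + 2)

theorem ins_of_lt {i j : ℕ} (u v : Bool) (x : ℕ → Bool) (h : j < i) : ins i u v x j = x j := by
  simp [ins, h]

@[simp] theorem ins_self (i : ℕ) (u v : Bool) (x : ℕ → Bool) : ins i u v x i = u := by
  simp [ins]

@[simp] theorem ins_succ (i : ℕ) (u v : Bool) (x : ℕ → Bool) : ins i u v x (i + 1) = v := by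
  simp [ins]

theorem ins_add_two {i j : ℕ} (u v : Bool) (x : ℕ → Bool) (h : i ≤ j) :
    ins i u v x (j + 2) = x j := by
  simp only [ins]
  rw [if_neg (by omega), if_neg (by omega), if_neg (by omega)]
  simp

@[simp] theorem del_ins (i : ℕ) (u v : Bool) (x : ℕ → Bool) : del i (ins i u v x) = x := by
  funext j
  simp only [del]
  split_ifs with h
  · rw [ins_of_lt _ _ _ h]
  · rw [ins_add_two _ _ _ (by omega)]

theorem del_ins_add_two (i k : ℕ) (u v : Bool) (x : ℕ → Bool) :
    del (i + 2 + k) (ins i u v x) = ins i u v (del (i + k) x) := by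
  funext j
  rcases lt_or_ge j (i + 2) with h | h
  · simp only [del, ins]
    grind
  · obtain ⟨j, rfl⟩ : ∃ j', j = j' + 2 := ⟨j - 2, by omega⟩
    rw [ins_add_two _ _ _ (by omega)]
    simp only [del]
    split_ifs
    · rw [ins_add_two _ _ _ (by omega)]
    · omega
    · omega
    · rw [ins_add_two _ _ _ (by omega)]

theorem del_ins_of_le (i k : ℕ) (u v : Bool) (x : ℕ → Bool) :
    del i (ins (i + 2 + k) u v x) = ins (i + k) u v (del i x) := by
  funext j
  simp only [del, ins]
  grind

theorem ins_ins (i k : ℕ) (u v u' v' : Bool) (x : ℕ → Bool) :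
    ins (i + 2 + k) u' v' (ins i u v x) = ins i u v (ins (i + k) u' v' x) := by
  funext j
  simp only [ins]
  grind (splits := 20)

theorem del_del (i k : ℕ) (x : ℕ → Bool) :
    del (i + k) (del i x) = del i (del (i + 2 + k) x) := by
  funext j
  simp only [del]
  grind

variable {k : Type*} [CommRing k] (a b : k)

/-- The weight of a maximum. -/
def capWeight : Bool → Bool → k
  | false, true => a
  | true, false => -b
  | _, _ => 0

/-- The operator of a maximum. -/
def capOp (i : ℕ) : Module.End k ((ℕ → Bool) → k) where
  toFun f x := capWeight a b (x i) (x (i + 1)) * f (del i x)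
  map_add' f g := by funext x; simp [mul_add]
  map_smul' c f := by funext x; simp [mul_left_comm]

/-- The operator of a minimum. -/
def cupOp (i : ℕ) : Module.End k ((ℕ → Bool) → k) where
  toFun f x := -a * f (ins i false true x) + b * f (ins i true false x)
  map_add' f g := by funext x; simp; ring
  map_smul' c f := by funext x; simp; ring

theorem capOp_apply (i : ℕ) (f : (ℕ → Bool) → k) (x : ℕ → Bool) :
    capOp a b i f x = capWeight a b (x i) (x (i + 1)) * f (del i x) := rfl

theorem cupOp_apply (i : ℕ) (f : (ℕ → Bool) → k) (x : ℕ → Bool) :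
    cupOp a b i f x = -a * f (ins i false true x) + b * f (ins i true false x) := rfl

/-- The operator of a slice. -/
def tileOp : Tile → ℕ → Module.End k ((ℕ → Bool) → k)
  | .cup, i => cupOp a b i
  | .cap, i => capOp a b i
  | .cross true, i => a • 1 + b • (capOp a b i * cupOp a b i)
  | .cross false, i => b • 1 + a • (capOp a b i * cupOp a b i)

/-- The operator of a diagram. -/
def wordOp (w : List Slice) : Module.End k ((ℕ → Bool) → k) :=
  (w.map fun s => tileOp a b s.tile s.pos).prod

@[simp] theorem wordOp_nil : wordOp a b [] = 1 := rfl

@[simp] theorem wordOp_cons (τ : Tile) (i : ℕ) (w : List Slice) :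
    wordOp a b (⟨τ, i⟩ :: w) = tileOp a b τ i * wordOp a b w := by simp [wordOp]

@[simp] theorem wordOp_append (u v : List Slice) :
    wordOp a b (u ++ v) = wordOp a b u * wordOp a b v := by simp [wordOp]

/-- The state sum of a closed diagram. -/
def stateSum (w : List Slice) : k := wordOp a b w (fun _ => 1) fun _ => false

variable {a b}

theorem cupOp_mul_capOp_self (i : ℕ) :
    cupOp a b i * capOp a b i = (-(a ^ 2 + b ^ 2)) • 1 := by
  ext f x
  simp [cupOp_apply, capOp_apply, capWeight]
  ring

theorem del_ins_succ (i : ℕ) (u v : Bool) (x : ℕ → Bool) (h : v = x i) :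
    del i (ins (i + 1) u v x) = x := by
  subst h
  funext j
  simp only [del, ins]
  grind

theorem del_succ_ins (i : ℕ) (u v : Bool) (x : ℕ → Bool) (h : u = x i) :
    del (i + 1) (ins i u v x) = x := by
  subst h
  funext j
  simp only [del, ins]
  grind

theorem cupOp_succ_mul_capOp (hab : a * b = 1) (i : ℕ) :
    cupOp a b (i + 1) * capOp a b i = 1 := by
  refine LinearMap.ext fun f => funext fun x => ?_
  simp only [Module.End.mul_apply, cupOp_apply, capOp_apply, ins_self,
    ins_of_lt _ _ x (Nat.lt_succ_self i), Module.End.one_apply]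
  cases h : x i
  · rw [del_ins_succ i true false x h.symm]
    simp only [capWeight]
    linear_combination f x * hab
  · rw [del_ins_succ i false true x h.symm]
    simp only [capWeight]
    linear_combination f x * hab

theorem cupOp_mul_capOp_succ (hab : a * b = 1) (i : ℕ) :
    cupOp a b i * capOp a b (i + 1) = 1 := by
  refine LinearMap.ext fun f => funext fun x => ?_
  simp only [Module.End.mul_apply, cupOp_apply, capOp_apply, ins_succ,
    Module.End.one_apply, show i + 1 + 1 = i + 2 from rfl, ins_add_two _ _ x le_rfl]
  cases h : x i
  · rw [del_succ_ins i false true x h.symm]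
    simp only [capWeight]
    linear_combination f x * hab
  · rw [del_succ_ins i true false x h.symm]
    simp only [capWeight]
    linear_combination f x * hab

theorem cupOp_mul_cupOp (i k : ℕ) :
    cupOp a b i * cupOp a b (i + 2 + k) = cupOp a b (i + k) * cupOp a b i := by
  refine LinearMap.ext fun f => funext fun x => ?_
  simp only [Module.End.mul_apply, cupOp_apply, ins_ins]
  ring

theorem cupOp_mul_capOp (i k : ℕ) :
    cupOp a b i * capOp a b (i + 2 + k) = capOp a b (i + k) * cupOp a b i := by
  refine LinearMap.ext fun f => funext fun x => ?_
  simp only [Module.End.mul_apply, cupOp_apply, capOp_apply,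
    show i + 2 + k = i + k + 2 by omega, show i + k + 2 + 1 = i + k + 1 + 2 by omega,
    ins_add_two _ _ x (show i ≤ i + k by omega), ins_add_two _ _ x (show i ≤ i + k + 1 by omega)]
  simp only [show i + k + 2 = i + 2 + k by omega, del_ins_add_two]
  ring

theorem capOp_mul_cupOp (i k : ℕ) :
    capOp a b i * cupOp a b (i + k) = cupOp a b (i + 2 + k) * capOp a b i := by
  refine LinearMap.ext fun f => funext fun x => ?_
  simp only [Module.End.mul_apply, cupOp_apply, capOp_apply, del_ins_of_le,
    ins_of_lt _ _ x (show i < i + 2 + k by omega), ins_of_lt _ _ x (show i + 1 < i + 2 + k by omega)]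
  ring

theorem capOp_mul_capOp (i k : ℕ) :
    capOp a b i * capOp a b (i + k) = capOp a b (i + 2 + k) * capOp a b i := by
  refine LinearMap.ext fun f => funext fun x => ?_
  have h1 : del i x (i + k) = x (i + 2 + k) := by simp only [del]; grind
  have h2 : del i x (i + k + 1) = x (i + 2 + k + 1) := by simp only [del]; grind
  have h3 : del (i + 2 + k) x i = x i := by simp only [del]; grind
  have h4 : del (i + 2 + k) x (i + 1) = x (i + 1) := by simp only [del]; grind
  simp only [Module.End.mul_apply, capOp_apply, h1, h2, h3, h4, del_del]
  ring

/-- Side by side slices of which the left one has no crossing commute. -/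
theorem tileOp_exchange_left (σ τ : Tile) (hσ : ∀ ε, σ ≠ .cross ε) (i k : ℕ) :
    tileOp a b σ i * tileOp a b τ (i + σ.top + k) =
      tileOp a b τ (i + σ.bot + k) * tileOp a b σ i := by
  have key : ∀ τ : Tile, (∀ ε, τ ≠ .cross ε) → ∀ k, tileOp a b σ i * tileOp a b τ (i + σ.top + k) =
      tileOp a b τ (i + σ.bot + k) * tileOp a b σ i := by
    intro τ hτ k
    cases σ with
    | cross ε => exact absurd rfl (hσ ε)
    | cup =>
      cases τ with
      | cross ε => exact absurd rfl (hτ ε)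
      | cup => exact cupOp_mul_cupOp i k
      | cap => exact cupOp_mul_capOp i k
    | cap =>
      cases τ with
      | cross ε => exact absurd rfl (hτ ε)
      | cup => exact capOp_mul_cupOp i k
      | cap => exact capOp_mul_capOp i k
  cases τ with
  | cup => exact key _ (by simp) k
  | cap => exact key _ (by simp) k
  | cross ε =>
    have h1 := key .cup (by simp) k
    have h2 := key .cap (by simp) k
    simp only [tileOp] at h1 h2
    cases ε <;>
    simp only [tileOp, mul_add, add_mul, mul_smul_comm, smul_mul_assoc, mul_one, one_mul] <;>
    rw [← mul_assoc, h2, mul_assoc, h1, mul_assoc]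

theorem tileOp_exchange (σ τ : Tile) (i k : ℕ) :
    tileOp a b σ i * tileOp a b τ (i + σ.top + k) =
      tileOp a b τ (i + σ.bot + k) * tileOp a b σ i := by
  cases σ with
  | cup => exact tileOp_exchange_left _ _ (by simp) i k
  | cap => exact tileOp_exchange_left _ _ (by simp) i k
  | cross ε =>
    have h1 := tileOp_exchange_left (a := a) (b := b) .cup τ (by simp) i k
    have h2 := tileOp_exchange_left (a := a) (b := b) .cap τ (by simp) i k
    simp only [tileOp, Tile.top, Tile.bot] at h1 h2
    cases ε <;>
    simp only [tileOp, Tile.top, Tile.bot, mul_add, add_mul, mul_smul_comm, smul_mul_assoc, mul_one,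
      one_mul] <;>
    rw [mul_assoc, h1, ← mul_assoc, h2, mul_assoc]

theorem wordOp_eq_of_move (hab : a * b = 1) {u v : List Slice} (h : Move u v) :
    wordOp a b u = wordOp a b v := by
  have z1 := cupOp_succ_mul_capOp hab
  have z2 := cupOp_mul_capOp_succ hab
  have d := cupOp_mul_capOp_self (a := a) (b := b)
  have z1' : ∀ i X, cupOp a b (i + 1) * (capOp a b i * X) = X := fun i X => by
    rw [← mul_assoc, z1, one_mul]
  have z2' : ∀ i X, cupOp a b i * (capOp a b (i + 1) * X) = X := fun i X => by
    rw [← mul_assoc, z2, one_mul]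
  have d' : ∀ i X, cupOp a b i * (capOp a b i * X) = (-(a ^ 2 + b ^ 2)) • X := fun i X => by
    rw [← mul_assoc, d, smul_mul_assoc, one_mul]
  cases h with
  | exchange σ τ i k => simpa using tileOp_exchange σ τ i k
  | zigzag_left i => simpa [tileOp] using z1 i
  | zigzag_right i => simpa [tileOp] using z2 i
  | slide_cup ε i =>
    cases ε <;> simp [tileOp, mul_add, z1', z2', add_comm]
  | slide_cap ε i =>
    cases ε <;> simp [tileOp, add_mul, mul_assoc, z1, z2, add_comm]
  | reidemeister_one ε i =>
    cases ε
    · simp [tileOp, add_mul, mul_add, mul_assoc, z1, z2, d]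
    · simp [tileOp, add_mul, mul_add, mul_assoc, z1, z2, d]
  | reidemeister_two ε i =>
    cases ε <;> simp only [tileOp, add_mul, mul_add, mul_assoc, d', wordOp_cons, wordOp_nil, mul_one,
      smul_mul_assoc, mul_smul_comm, one_mul, Bool.not_true, Bool.not_false] <;> match_scalars <;> grind
  | reidemeister_three ε i =>
    cases ε <;> simp only [tileOp, add_mul, mul_add, mul_assoc, z1', z2', d', wordOp_cons, wordOp_nil,
      mul_one, smul_mul_assoc, mul_smul_comm, one_mul] <;> match_scalars <;> grind

theorem stateSum_eq_of_step (hab : a * b = 1) {D D' : LinkDiagram} (h : D.Step D') :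
    stateSum a b D.1 = stateSum a b D'.1 := by
  obtain ⟨u, v, p, q, hm, e, e'⟩ := h
  simp only [stateSum, e, e', wordOp_append, wordOp_eq_of_move hab hm]

theorem stateSum_addCircle (D : LinkDiagram) :
    stateSum a b D.addCircle.1 = -(a ^ 2 + b ^ 2) * stateSum a b D.1 := by
  have d := cupOp_mul_capOp_self (a := a) (b := b) 0
  simp [stateSum, LinkDiagram.addCircle, tileOp, d]

theorem stateSum_cross_true (u v : List Slice) (i : ℕ) :
    stateSum a b (u ++ [⟨.cross true, i⟩] ++ v) =
      a * stateSum a b (u ++ v) + b * stateSum a b (u ++ [⟨.cap, i⟩, ⟨.cup, i⟩] ++ v) := by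
  simp [stateSum, tileOp]

theorem stateSum_cross_false (u v : List Slice) (i : ℕ) :
    stateSum a b (u ++ [⟨.cross false, i⟩] ++ v) =
      b * stateSum a b (u ++ v) + a * stateSum a b (u ++ [⟨.cap, i⟩, ⟨.cup, i⟩] ++ v) := by
  simp [stateSum, tileOp]

theorem map_capWeight {l : Type*} [CommRing l] (φ : k →+* l) (u v : Bool) :
    φ (capWeight a b u v) = capWeight (φ a) (φ b) u v := by
  cases u <;> cases v <;> simp [capWeight]

theorem map_tileOp {l : Type*} [CommRing l] (φ : k →+* l) (τ : Tile) (i : ℕ)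
    (f : (ℕ → Bool) → k) :
    (fun x => φ (tileOp a b τ i f x)) = tileOp (φ a) (φ b) τ i fun x => φ (f x) := by
  funext x
  rcases τ with _ | _ | _ | _ <;>
    simp [tileOp, cupOp_apply, capOp_apply, map_capWeight]

theorem map_wordOp {l : Type*} [CommRing l] (φ : k →+* l) (w : List Slice) (f : (ℕ → Bool) → k) :
    (fun x => φ (wordOp a b w f x)) = wordOp (φ a) (φ b) w fun x => φ (f x) := by
  induction w with
  | nil => rfl
  | cons s w ih =>
    obtain ⟨τ, i⟩ := s
    simp only [wordOp_cons, Module.End.mul_apply, ← ih, ← map_tileOp]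

theorem map_stateSum {l : Type*} [CommRing l] (φ : k →+* l) (w : List Slice) :
    φ (stateSum a b w) = stateSum (φ a) (φ b) w := by
  have := congrFun (map_wordOp (a := a) (b := b) φ w fun _ => 1) fun _ => false
  simpa [stateSum] using this

end StateSum

/-! ### Existence and uniqueness of the bracket -/

theorem Tile.top_cup : Tile.cup.top = 2 := rfl
theorem Tile.bot_cup : Tile.cup.bot = 0 := rfl
theorem Tile.top_cap : Tile.cap.top = 0 := rfl
theorem Tile.bot_cap : Tile.cap.bot = 2 := rfl
theorem Tile.top_cross (ε : Bool) : (Tile.cross ε).top = 2 := rfl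
theorem Tile.bot_cross (ε : Bool) : (Tile.cross ε).bot = 2 := rfl

theorem isTangle_nil_iff {n n' : ℕ} : IsTangle n [] n' ↔ n = n' := by
  constructor
  · rintro ⟨⟩
    rfl
  · rintro rfl
    exact .nil _

theorem isTangle_cons_iff {n n' i : ℕ} {τ : Tile} {w : List Slice} :
    IsTangle n (⟨τ, i⟩ :: w) n' ↔
      ∃ k, n = i + τ.bot + k ∧ IsTangle (i + τ.top + k) w n' := by
  constructor
  · intro h
    cases h with
    | cons _ _ k _ _ h => exact ⟨k, rfl, h⟩
  · rintro ⟨k, rfl, h⟩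
    exact .cons _ _ _ _ _ h

theorem isTangle_cons_iff_le {n n' i : ℕ} {τ : Tile} {w : List Slice} :
    IsTangle n (⟨τ, i⟩ :: w) n' ↔ i + τ.bot ≤ n ∧ IsTangle (n - τ.bot + τ.top) w n' := by
  rw [isTangle_cons_iff]
  constructor
  · rintro ⟨k, rfl, h⟩
    exact ⟨by omega, by convert h using 1; omega⟩
  · rintro ⟨h1, h2⟩
    exact ⟨n - (i + τ.bot), by omega, by convert h2 using 1; omega⟩

theorem isTangle_append_iff {n n' : ℕ} {u v : List Slice} :
    IsTangle n (u ++ v) n' ↔ ∃ m, IsTangle n u m ∧ IsTangle m v n' := by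
  constructor
  · induction u generalizing n with
    | nil => exact fun h => ⟨n, .nil _, h⟩
    | cons s u ih =>
      intro h
      obtain ⟨τ, i⟩ := s
      obtain ⟨k, rfl, h'⟩ := isTangle_cons_iff.1 h
      obtain ⟨m, h1, h2⟩ := ih h'
      exact ⟨m, .cons _ _ _ _ _ h1, h2⟩
  · rintro ⟨m, h1, h2⟩
    exact h1.append h2

open Classical in
/-- The skein class of a list of slices, `0` if it is not a link diagram. -/
noncomputable def wordSkein (w : List Slice) : SkeinModule :=
  if h : IsTangle 0 w 0 then (LinkDiagram.toLink ⟨w, h⟩).skein else 0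

theorem wordSkein_eq {w : List Slice} (h : IsTangle 0 w 0) :
    wordSkein w = (LinkDiagram.toLink ⟨w, h⟩).skein := dif_pos h

theorem wordSkein_move {p q : List Slice} (h : Move p q) (u v : List Slice)
    (hp : IsTangle 0 (u ++ p ++ v) 0) (hq : IsTangle 0 (u ++ q ++ v) 0) :
    wordSkein (u ++ p ++ v) = wordSkein (u ++ q ++ v) := by
  rw [wordSkein_eq hp, wordSkein_eq hq]
  congr 1
  exact Quot.sound ⟨u, v, p, q, h, rfl, rfl⟩

theorem skein_relation_cross {T₁ Tinf T₀ : FramedLink} (h : IsKauffmanTriple T₁ Tinf T₀) :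
    T₁.skein = A • Tinf.skein + Ainv • T₀.skein := by
  have hmem : -Finsupp.single T₁ 1 + A • Finsupp.single Tinf 1 + Ainv • Finsupp.single T₀ 1 ∈
      skeinRelations := Submodule.subset_span (Or.inl ⟨_, _, _, h, rfl⟩)
  have h0 := (Submodule.Quotient.mk_eq_zero _).2 hmem
  change skeinRelations.mkQ _ = 0 at h0
  simp only [map_add, map_neg, map_smul] at h0
  change -T₁.skein + A • Tinf.skein + Ainv • T₀.skein = 0 at h0
  rw [add_assoc, neg_add_eq_zero] at h0
  exact h0

theorem skein_relation_circle (D : LinkDiagram) :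
    D.addCircle.toLink.skein = (-(A ^ 2 + Ainv ^ 2)) • D.toLink.skein := by
  have hmem : Finsupp.single D.addCircle.toLink 1 +
      (A ^ 2 + Ainv ^ 2) • Finsupp.single D.toLink 1 ∈ skeinRelations :=
    Submodule.subset_span (Or.inr ⟨_, rfl⟩)
  have h0 := (Submodule.Quotient.mk_eq_zero _).2 hmem
  change skeinRelations.mkQ _ = 0 at h0
  simp only [map_add, map_smul] at h0
  change D.addCircle.toLink.skein + (A ^ 2 + Ainv ^ 2) • D.toLink.skein = 0 at h0
  rw [neg_smul]
  exact eq_neg_of_add_eq_zero_left h0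

theorem IsTangle.smooth {u v : List Slice} {ε : Bool} {i : ℕ}
    (h : IsTangle 0 (u ++ [⟨.cross ε, i⟩] ++ v) 0) :
    IsTangle 0 (u ++ v) 0 ∧ IsTangle 0 (u ++ [⟨.cap, i⟩, ⟨.cup, i⟩] ++ v) 0 := by
  simp only [isTangle_append_iff, isTangle_cons_iff, isTangle_nil_iff] at h ⊢
  obtain ⟨m, ⟨m', hu, k, rfl, rfl⟩, hv⟩ := h
  exact ⟨⟨_, hu, hv⟩, _, ⟨_, hu, k, rfl, k, rfl, rfl⟩, hv⟩

theorem wordSkein_cross (u v : List Slice) (ε : Bool) (i : ℕ)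
    (h : IsTangle 0 (u ++ [⟨.cross ε, i⟩] ++ v) 0) :
    wordSkein (u ++ [⟨.cross ε, i⟩] ++ v) =
      (if ε then A else Ainv) • wordSkein (u ++ v) +
        (if ε then Ainv else A) • wordSkein (u ++ [⟨.cap, i⟩, ⟨.cup, i⟩] ++ v) := by
  obtain ⟨h1, h2⟩ := h.smooth
  rw [wordSkein_eq h, wordSkein_eq h1, wordSkein_eq h2]
  cases ε
  · rw [add_comm]
    exact skein_relation_cross
      ⟨⟨_, h⟩, ⟨_, h2⟩, ⟨_, h1⟩, u, v, i, rfl, rfl, rfl, Or.inr ⟨rfl, rfl, rfl⟩⟩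
  · exact skein_relation_cross
      ⟨⟨_, h⟩, ⟨_, h1⟩, ⟨_, h2⟩, u, v, i, rfl, rfl, rfl, Or.inl ⟨rfl, rfl, rfl⟩⟩

/-- A circle passes under a strand on its left. -/
theorem wordSkein_circle_left (u v : List Slice) (i : ℕ)
    (h : IsTangle 0 (u ++ [⟨.cup, i + 1⟩, ⟨.cap, i + 1⟩] ++ v) 0) :
    wordSkein (u ++ [⟨.cup, i + 1⟩, ⟨.cap, i + 1⟩] ++ v) =
      wordSkein (u ++ [⟨.cup, i⟩, ⟨.cap, i⟩] ++ v) := by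
  obtain ⟨m, hu, hm, hv⟩ : ∃ m, IsTangle 0 u m ∧ i + 1 ≤ m ∧ IsTangle m v 0 := by
    simp only [isTangle_append_iff, isTangle_cons_iff_le, isTangle_nil_iff, Tile.top_cup,
      Tile.bot_cup, Tile.top_cap, Tile.bot_cap] at h
    obtain ⟨m, ⟨m', hu, h1, h2, h3⟩, hv⟩ := h
    exact ⟨_, hu, by omega, by convert hv using 1; omega⟩
  have ht : ∀ w, IsTangle m w m → IsTangle 0 (u ++ (w ++ v)) 0 := fun w hw =>
    hu.append (hw.append hv)
  have e1 := wordSkein_move (.reidemeister_two true i) (u ++ [⟨.cup, i + 1⟩])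
    ([⟨.cap, i + 1⟩] ++ v)
  have e2 := wordSkein_move (.slide_cup false i) u ([⟨.cross false, i⟩, ⟨.cap, i + 1⟩] ++ v)
  have e3 := wordSkein_move (.slide_cap false i) (u ++ [⟨.cup, i⟩, ⟨.cross false, i + 1⟩]) v
  have e4 := wordSkein_move (.reidemeister_two false (i + 1)) (u ++ [⟨.cup, i⟩]) ([⟨.cap, i⟩] ++ v)
  simp only [Bool.not_true, Bool.not_false, List.append_assoc, List.cons_append,
    List.nil_append] at *
  rw [← e1, ← e2, e3, e4]
  all_goals
    first
    | refine ht [_, _] ?_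
    | refine ht [_, _, _, _] ?_
    simp only [isTangle_cons_iff_le, isTangle_nil_iff, Tile.top, Tile.bot]
    omega

/-- A circle on the left of a diagram moves upwards. -/
theorem wordSkein_circle_up (u v : List Slice) (s : Slice)
    (h : IsTangle 0 (u ++ [⟨.cup, 0⟩, ⟨.cap, 0⟩] ++ s :: v) 0) :
    wordSkein (u ++ [⟨.cup, 0⟩, ⟨.cap, 0⟩] ++ s :: v) =
      wordSkein ((u ++ [s]) ++ [⟨.cup, 0⟩, ⟨.cap, 0⟩] ++ v) := by
  obtain ⟨τ, j⟩ := s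
  obtain ⟨m, m', hu, hm, hm', hv⟩ :
      ∃ m m', IsTangle 0 u m ∧ j + τ.bot ≤ m ∧ m' = m - τ.bot + τ.top ∧ IsTangle m' v 0 := by
    simp only [isTangle_append_iff, isTangle_cons_iff_le, isTangle_nil_iff, Tile.top_cup,
      Tile.bot_cup, Tile.top_cap, Tile.bot_cap] at h
    obtain ⟨m, ⟨m', hu, h1, h2, h3⟩, h4, hv⟩ := h
    exact ⟨_, _, hu, by omega, rfl, by convert hv using 1; omega⟩
  have ht : ∀ w, IsTangle m w m' → IsTangle 0 (u ++ (w ++ v)) 0 := fun w hw =>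
    hu.append (hw.append hv)
  have e1 := wordSkein_move (.exchange .cap τ 0 j) (u ++ [⟨.cup, 0⟩]) v
  have e2 := wordSkein_move (.exchange .cup τ 0 j) u ([⟨.cap, 0⟩] ++ v)
  simp only [Tile.top_cup, Tile.bot_cup, Tile.top_cap, Tile.bot_cap, zero_add, List.append_assoc, List.cons_append,
    List.nil_append] at *
  rw [e1, e2]
  all_goals
    refine ht [_, _, _] ?_
    simp only [isTangle_cons_iff_le, isTangle_nil_iff, Tile.top_cup, Tile.bot_cup,
      Tile.top_cap, Tile.bot_cap]
    omega

theorem wordSkein_circle_zero (u v : List Slice)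
    (h : IsTangle 0 (u ++ [⟨.cup, 0⟩, ⟨.cap, 0⟩] ++ v) 0) :
    wordSkein (u ++ [⟨.cup, 0⟩, ⟨.cap, 0⟩] ++ v) =
      (-(A ^ 2 + Ainv ^ 2)) • wordSkein (u ++ v) := by
  induction v generalizing u with
  | nil =>
    have h' : IsTangle 0 u 0 := by
      simp only [isTangle_append_iff, isTangle_cons_iff_le, isTangle_nil_iff, Tile.top_cup,
        Tile.bot_cup, Tile.top_cap, Tile.bot_cap] at h
      obtain ⟨m, ⟨m', hu, h1, h2, h3⟩, h4⟩ := h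
      rwa [show m' = 0 by omega] at hu
    simp only [List.append_nil]
    rw [wordSkein_eq h', wordSkein_eq (h'.append isTangle_circle)]
    exact skein_relation_circle ⟨u, h'⟩
  | cons s v ih =>
    have e := wordSkein_circle_up u v s h
    rw [e, ih, List.append_assoc]
    · rfl
    · obtain ⟨τ, j⟩ := s
      simp only [isTangle_append_iff, isTangle_cons_iff_le, isTangle_nil_iff, Tile.top_cup,
        Tile.bot_cup, Tile.top_cap, Tile.bot_cap] at h ⊢
      obtain ⟨m, ⟨m', hu, h1, h2, h3⟩, h4, hv⟩ := h
      exact ⟨m' - τ.bot + τ.top, ⟨m' - τ.bot + τ.top, ⟨m', hu, by omega, rfl⟩, by omega, by omega,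
        by omega⟩, by convert hv using 1; omega⟩

theorem wordSkein_circle (u v : List Slice) (i : ℕ)
    (h : IsTangle 0 (u ++ [⟨.cup, i⟩, ⟨.cap, i⟩] ++ v) 0) :
    wordSkein (u ++ [⟨.cup, i⟩, ⟨.cap, i⟩] ++ v) =
      (-(A ^ 2 + Ainv ^ 2)) • wordSkein (u ++ v) := by
  induction i with
  | zero => exact wordSkein_circle_zero u v h
  | succ i ih =>
    rw [wordSkein_circle_left u v i h]
    apply ih
    simp only [isTangle_append_iff, isTangle_cons_iff_le, isTangle_nil_iff, Tile.top_cup,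
      Tile.bot_cup, Tile.top_cap, Tile.bot_cap] at h ⊢
    obtain ⟨m, ⟨m', hu, h1, h2, h3⟩, hv⟩ := h
    exact ⟨m', ⟨m', hu, by omega, by omega, by omega⟩, by convert hv using 1; omega⟩

theorem wordSkein_cups_cap (u v : List Slice) (j : ℕ) (hu : ∀ s ∈ u, s.tile = .cup)
    (hv : ∀ s ∈ v, ∀ ε, s.tile ≠ .cross ε) (h : IsTangle 0 (u ++ ⟨.cap, j⟩ :: v) 0) :
    ∃ (c : ℚ[T;T⁻¹]) (w : List Slice), IsTangle 0 w 0 ∧ (∀ s ∈ w, ∀ ε, s.tile ≠ .cross ε) ∧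
      w.length < (u ++ ⟨.cap, j⟩ :: v).length ∧
      wordSkein (u ++ ⟨.cap, j⟩ :: v) = c • wordSkein w := by
  induction u using List.reverseRecOn generalizing v j with
  | nil =>
    simp [isTangle_cons_iff_le, Tile.bot] at h
  | append_singleton u s ih =>
    obtain ⟨τ, i⟩ := s
    obtain rfl : τ = .cup := hu ⟨τ, i⟩ (by simp)
    have hu' : ∀ s ∈ u, s.tile = .cup := fun s hs => hu s (by simp [hs])
    have hc : ∀ s ∈ u ++ v, ∀ ε, s.tile ≠ .cross ε := by
      intro s hs ε
      rcases List.mem_append.1 hs with hs | hs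
      · simp [hu' s hs]
      · exact hv s hs ε
    obtain ⟨m, hm, h1, h2, h3⟩ : ∃ m, IsTangle 0 u m ∧ i ≤ m ∧ j ≤ m ∧ IsTangle m v 0 := by
      simp only [isTangle_append_iff, isTangle_cons_iff_le, isTangle_nil_iff, Tile.top_cup,
        Tile.bot_cup, Tile.top_cap, Tile.bot_cap] at h
      obtain ⟨m, ⟨m', hu, h1, h2⟩, h3, hv⟩ := h
      exact ⟨m', hu, by omega, by omega, by convert hv using 1; omega⟩
    have ht : ∀ w, IsTangle m w m → IsTangle 0 (u ++ w ++ v) 0 := fun w hw =>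
      (hm.append hw).append h3
    have hzz : ∀ w, IsTangle m w m → Move w [] → wordSkein (u ++ w ++ v) =
        (1 : ℚ[T;T⁻¹]) • wordSkein (u ++ v) := fun w hw hmove => by
      rw [wordSkein_move hmove u v (ht w hw) (ht [] (.nil _)), one_smul]
      simp
    have e0 : (u ++ [⟨.cup, i⟩]) ++ ⟨.cap, j⟩ :: v = u ++ [⟨.cup, i⟩, ⟨.cap, j⟩] ++ v := by simp
    have hl : (u ++ v).length < (u ++ ([⟨.cup, i⟩, ⟨.cap, j⟩] : List Slice) ++ v).length := by
      simp only [List.length_append, List.length_cons]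
      omega
    rw [e0] at h ⊢
    have hex : ∀ j' i', Move [⟨.cup, i⟩, ⟨.cap, j⟩] [⟨.cap, j'⟩, ⟨.cup, i'⟩] ∨
        Move [⟨.cap, j'⟩, ⟨.cup, i'⟩] [⟨.cup, i⟩, ⟨.cap, j⟩] →
        j' + 2 ≤ m → i' + 2 ≤ m →
        ∃ (c : ℚ[T;T⁻¹]) (w : List Slice), IsTangle 0 w 0 ∧
          (∀ s ∈ w, ∀ ε, s.tile ≠ .cross ε) ∧
          w.length < (u ++ ([⟨.cup, i⟩, ⟨.cap, j⟩] : List Slice) ++ v).length ∧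
          wordSkein (u ++ [⟨.cup, i⟩, ⟨.cap, j⟩] ++ v) = c • wordSkein w := by
      intro j' i' hmove hj hi
      have h' : IsTangle 0 (u ++ [⟨.cap, j'⟩, ⟨.cup, i'⟩] ++ v) 0 := ht _ (by
        simp only [isTangle_cons_iff_le, isTangle_nil_iff, Tile.top, Tile.bot]
        omega)
      have e : wordSkein (u ++ [⟨.cup, i⟩, ⟨.cap, j⟩] ++ v) =
          wordSkein (u ++ [⟨.cap, j'⟩, ⟨.cup, i'⟩] ++ v) := by
        rcases hmove with hmove | hmove
        · exact wordSkein_move hmove u v h h'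
        · exact (wordSkein_move hmove u v h' h).symm
      have e1 : u ++ [⟨.cap, j'⟩, ⟨.cup, i'⟩] ++ v = u ++ ⟨.cap, j'⟩ :: ⟨.cup, i'⟩ :: v := by simp
      rw [e1] at h' e
      obtain ⟨c, w, hw, hw', hlen, ew⟩ := ih (⟨.cup, i'⟩ :: v) j' hu' (by
        intro s hs ε
        rcases List.mem_cons.1 hs with rfl | hs
        · simp
        · exact hv s hs ε) h'
      refine ⟨c, w, hw, hw', ?_, e.trans ew⟩
      simpa using hlen
    have hcase : i = j ∨ i = j + 1 ∨ j = i + 1 ∨ (∃ k, j = i + 2 + k) ∨ ∃ k, i = j + 2 + k := by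
      rcases Nat.lt_or_ge i (j + 2) with h | h
      · rcases Nat.lt_or_ge j (i + 2) with h' | h'
        · omega
        · exact Or.inr (Or.inr (Or.inr (Or.inl ⟨j - (i + 2), by omega⟩)))
      · exact Or.inr (Or.inr (Or.inr (Or.inr ⟨i - (j + 2), by omega⟩)))
    have h0 : IsTangle 0 (u ++ v) 0 := hm.append h3
    rcases hcase with rfl | rfl | rfl | ⟨k, rfl⟩ | ⟨k, rfl⟩
    · exact ⟨_, _, h0, hc, hl, wordSkein_circle u v i h⟩
    · refine ⟨_, _, h0, hc, hl, hzz _ ?_ (.zigzag_left j)⟩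
      simp only [isTangle_cons_iff_le, isTangle_nil_iff, Tile.top, Tile.bot]
      omega
    · refine ⟨_, _, h0, hc, hl, hzz _ ?_ (.zigzag_right i)⟩
      simp only [isTangle_cons_iff_le, isTangle_nil_iff, Tile.top, Tile.bot]
      omega
    · exact hex (i + k) i (Or.inl (.exchange .cup .cap i k)) (by omega) (by omega)
    · exact hex j (j + k) (Or.inr (.exchange .cap .cup j k)) (by omega) (by omega)

theorem exists_wordSkein_of_no_cross (w : List Slice) (h : IsTangle 0 w 0)
    (hc : ∀ s ∈ w, ∀ ε, s.tile ≠ .cross ε) :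
    ∃ p : ℚ[T;T⁻¹], wordSkein w = p • skeinEmpty := by
  induction hn : w.length using Nat.strong_induction_on generalizing w with
  | _ n ih =>
    subst hn
    by_cases hcap : ∃ s ∈ w, s.tile = .cap
    · obtain ⟨u, v, j, rfl, hu⟩ : ∃ u v j, w = u ++ ⟨.cap, j⟩ :: v ∧ ∀ s ∈ u, s.tile = .cup := by
        clear ih h
        induction w with
        | nil => simp at hcap
        | cons s w ihw =>
          obtain ⟨τ, i⟩ := s
          cases τ with
          | cap => exact ⟨[], w, i, rfl, by simp⟩
          | cross ε => exact absurd rfl (hc ⟨.cross ε, i⟩ (by simp) ε)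
          | cup =>
            obtain ⟨u, v, j, rfl, hu⟩ := ihw (fun s hs => hc s (by simp [hs])) (by simpa using hcap)
            exact ⟨⟨.cup, i⟩ :: u, v, j, rfl, by simpa using hu⟩
      obtain ⟨c, w, hw, hw', hl, e⟩ := wordSkein_cups_cap u v j hu (fun s hs => hc s (by simp [hs])) h
      obtain ⟨p, hp⟩ := ih _ hl w hw hw' rfl
      exact ⟨c * p, by rw [e, hp, mul_smul]⟩
    · have key : ∀ (w : List Slice) n, (∀ s ∈ w, s.tile = .cup) → IsTangle n w 0 → w = [] := by
        intro w
        induction w with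
        | nil => intros; rfl
        | cons s w ihw =>
          intro n hs ht
          obtain ⟨τ, i⟩ := s
          obtain rfl : τ = .cup := hs ⟨τ, i⟩ (by simp)
          obtain ⟨k, rfl, ht'⟩ := isTangle_cons_iff.1 ht
          obtain rfl := ihw _ (fun s h => hs s (by simp [h])) ht'
          simp [isTangle_nil_iff, Tile.top] at ht'
      have hw : w = [] := key w 0 (fun s hs => by
        have h1 := hc s hs
        have h2 := fun e => hcap ⟨s, hs, e⟩
        revert h1 h2
        cases s.tile <;> simp) h
      subst hw
      exact ⟨1, by rw [wordSkein_eq h, one_smul]; rfl⟩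

/-- The number of crossings. -/
def crossings (w : List Slice) : ℕ :=
  w.countP fun s => match s.tile with
    | .cross _ => true
    | _ => false

theorem exists_wordSkein (w : List Slice) (h : IsTangle 0 w 0) :
    ∃ p : ℚ[T;T⁻¹], wordSkein w = p • skeinEmpty := by
  induction hn : crossings w using Nat.strong_induction_on generalizing w with
  | _ n ih =>
    subst hn
    by_cases hc : ∀ s ∈ w, ∀ ε, s.tile ≠ .cross ε
    · exact exists_wordSkein_of_no_cross w h hc
    · push Not at hc
      obtain ⟨⟨τ, i⟩, hs, ε, rfl⟩ := hc
      obtain ⟨u, v, rfl⟩ := List.append_of_mem hs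
      have e : u ++ ⟨.cross ε, i⟩ :: v = u ++ [⟨.cross ε, i⟩] ++ v := by simp
      rw [e] at h ih ⊢
      obtain ⟨h1, h2⟩ := h.smooth
      obtain ⟨p, hp⟩ := ih _ (by simp [crossings]) _ h1 rfl
      obtain ⟨q, hq⟩ := ih _ (by simp [crossings]) _ h2 rfl
      refine ⟨(if ε then A else Ainv) * p + (if ε then Ainv else A) * q, ?_⟩
      rw [wordSkein_cross u v ε i h, hp, hq, add_smul, mul_smul, mul_smul]

theorem A_mul_Ainv : A * Ainv = 1 := by
  rw [A, Ainv, ← LaurentPolynomial.T_add, add_neg_cancel, LaurentPolynomial.T_zero]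

/-- The state sum of a framed link. -/
noncomputable def FramedLink.stateSum (L : FramedLink) : ℚ[T;T⁻¹] :=
  Quot.lift (fun D : LinkDiagram => Skein.stateSum A Ainv D.1)
    (fun _ _ h => stateSum_eq_of_step A_mul_Ainv h) L

theorem stateSum_of_isKauffmanTriple {T₁ Tinf T₀ : FramedLink} (h : IsKauffmanTriple T₁ Tinf T₀) :
    T₁.stateSum = A * Tinf.stateSum + Ainv * T₀.stateSum := by
  obtain ⟨D₁, Dinf, D₀, u, v, i, rfl, rfl, rfl, ⟨h1, h2, h3⟩ | ⟨h1, h2, h3⟩⟩ := h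
  · change Skein.stateSum A Ainv D₁.1 =
      A * Skein.stateSum A Ainv Dinf.1 + Ainv * Skein.stateSum A Ainv D₀.1
    rw [h1, h2, h3, stateSum_cross_true]
  · change Skein.stateSum A Ainv D₁.1 =
      A * Skein.stateSum A Ainv Dinf.1 + Ainv * Skein.stateSum A Ainv D₀.1
    rw [h1, h2, h3, stateSum_cross_false, add_comm]

/-- The state sum as a functional on the skein module. -/
noncomputable def skeinStateSum : SkeinModule →ₗ[ℚ[T;T⁻¹]] ℚ[T;T⁻¹] :=
  skeinRelations.liftQ (Finsupp.linearCombination _ FramedLink.stateSum) (by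
    rw [skeinRelations, Submodule.span_le]
    rintro x (⟨T₁, Tinf, T₀, h, rfl⟩ | ⟨D, rfl⟩)
    · simp [stateSum_of_isKauffmanTriple h, add_assoc]
    · have h := stateSum_addCircle (a := A) (b := Ainv) D
      change D.addCircle.toLink.stateSum = _ * D.toLink.stateSum at h
      simp [h]
      ring)

theorem skeinStateSum_skein (L : FramedLink) : skeinStateSum L.skein = L.stateSum := by
  simp [skeinStateSum, FramedLink.skein]

theorem skeinStateSum_skeinEmpty : skeinStateSum skeinEmpty = 1 := by
  rw [skeinEmpty, skeinStateSum_skein]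
  simp [FramedLink.stateSum, LinkDiagram.toLink, Skein.stateSum, LinkDiagram.empty]

theorem skein_eq_smul_iff (L : FramedLink) (p : ℚ[T;T⁻¹]) :
    L.skein = p • skeinEmpty ↔ p = L.stateSum := by
  have key : ∀ q : ℚ[T;T⁻¹], L.skein = q • skeinEmpty → q = L.stateSum := fun q hq => by
    have := congrArg skeinStateSum hq
    rw [skeinStateSum_skein, map_smul, skeinStateSum_skeinEmpty, smul_eq_mul, mul_one] at this
    exact this.symm
  refine ⟨key p, ?_⟩
  rintro rfl
  induction L using Quot.ind with
  | mk D =>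
    obtain ⟨p, hp⟩ := exists_wordSkein D.1 D.2
    rw [wordSkein_eq D.2] at hp
    rw [← key p hp]
    exact hp

theorem kauffmanBracket_eq_stateSum (L : FramedLink) : kauffmanBracket L = L.stateSum :=
  (skein_eq_smul_iff L _).1 <| Classical.epsilon_spec (p := fun p => L.skein = p • skeinEmpty)
    ⟨_, (skein_eq_smul_iff L _).2 rfl⟩

/-! ### State sums of sublinks -/

section Sublink

variable {k : Type*} [CommRing k] (a b : k)

/-- The transposition of `i` and `i + 1`. -/
def transp (i j : ℕ) : ℕ := if j = i then i + 1 else if j = i + 1 then i else j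

@[simp] theorem transp_left (i : ℕ) : transp i i = i + 1 := by simp [transp]

@[simp] theorem transp_right (i : ℕ) : transp i (i + 1) = i := by simp [transp]

theorem transp_of_ne {i j : ℕ} (h : j ≠ i) (h' : j ≠ i + 1) : transp i j = j := by
  simp [transp, h, h']

open Classical in
/-- The operator of a slice from which the strands that are not kept are erased, on functions of
the colours of all strands. -/
noncomputable def keptOp (kept : ℕ → ℕ → Prop) (t : ℕ) (s : Slice) (f : (ℕ → Bool) → k) :
    (ℕ → Bool) → k :=
  if s.Survives kept t then tileOp a b s.tile s.pos f else fun x =>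
    match s.tile with
    | .cup => f (ins s.pos false false x)
    | .cap => f (del s.pos x)
    | .cross _ => f fun j => x (transp s.pos j)

/-- The state sum of a diagram from which the strands that are not kept are erased. -/
noncomputable def keptSum (kept : ℕ → ℕ → Prop) : ℕ → List Slice → (ℕ → Bool) → k
  | _, [] => fun _ => 1
  | t, s :: w => keptOp a b kept t s (keptSum kept (t + 1) w)

theorem keptCount_le (kept : ℕ → ℕ → Prop) (t : ℕ) {i j : ℕ} (h : i ≤ j) :
    keptCount kept t i ≤ keptCount kept t j := by
  classical
  unfold keptCount
  gcongr

theorem keptCount_lt (kept : ℕ → ℕ → Prop) (t : ℕ) {i j : ℕ} (h : i < j) (hk : kept t i) :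
    keptCount kept t i < keptCount kept t j := by
  classical
  have := keptCount_le kept t (show i + 1 ≤ j from h)
  rw [keptCount_succ, if_pos hk] at this
  omega

/-- `y` lists the colours of the kept strands among the first `n` ones at level `t`. -/
def Compresses (kept : ℕ → ℕ → Prop) (t n : ℕ) (x y : ℕ → Bool) : Prop :=
  ∀ j < n, kept t j → y (keptCount kept t j) = x j

variable {a b} {kept : ℕ → ℕ → Prop} {t i k' : ℕ} {x y : ℕ → Bool}

theorem Compatible.keptCount_left {τ : Tile} (hc : Compatible kept t k' τ i) {j : ℕ} (hj : j ≤ i) :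
    keptCount kept (t + 1) j = keptCount kept t j :=
  (keptCount_congr kept fun r hr => hc.left r (by omega)).symm

theorem Compatible.keptCount_right {τ : Tile} (hc : Compatible kept t k' τ i) {r : ℕ}
    (hr : r ≤ k') : ∃ c, keptCount kept t (i + τ.bot + r) = keptCount kept t (i + τ.bot) + c ∧
      keptCount kept (t + 1) (i + τ.top + r) = keptCount kept (t + 1) (i + τ.top) + c :=
  keptCount_add_congr kept fun j hj => hc.right j (by omega)

theorem Compresses.cup_of_kept (hc : Compatible kept t k' .cup i)
    (hxy : Compresses kept t (i + k') x y) (hk : kept (t + 1) i) (u v : Bool) :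
    Compresses kept (t + 1) (i + 2 + k') (ins i u v x) (ins (keptCount kept t i) u v y) := by
  classical
  have h0 := hc.keptCount_left le_rfl
  have h1 := keptCount_succ kept (t + 1) i
  have h2 := keptCount_succ kept (t + 1) (i + 1)
  rw [if_pos hk, h0] at h1
  rw [if_pos ((hc.cup rfl).1 hk), h1] at h2
  intro j hj hkj
  rcases lt_or_ge j i with h | h
  · have hkj' := (hc.left j h).2 hkj
    rw [hc.keptCount_left h.le, ins_of_lt _ _ _ h, ins_of_lt _ _ _ (keptCount_lt kept t h hkj'),
      hxy j (by omega) hkj']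
  obtain rfl | rfl | ⟨r, rfl⟩ : j = i ∨ j = i + 1 ∨ ∃ r, j = i + 2 + r := by
    rcases lt_or_ge j (i + 2) with h' | h'
    · omega
    · exact Or.inr (Or.inr ⟨j - (i + 2), by omega⟩)
  · rw [h0, ins_self, ins_self]
  · rw [h1, ins_succ, ins_succ]
  · obtain ⟨c, e1, e2⟩ := hc.keptCount_right (show r ≤ k' by omega)
    have hkj' := (hc.right r (by omega)).2 hkj
    have := hxy _ (by simp only [Tile.bot_cup]; omega) hkj'
    simp only [Tile.top_cup, Tile.bot_cup, add_zero] at e1 e2 this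
    rw [e1] at this
    rw [e2, show i + 2 = i + 1 + 1 from rfl, h2,
      show keptCount kept t i + 1 + 1 + c = keptCount kept t i + c + 2 by omega,
      show i + 1 + 1 + r = i + r + 2 by omega, ins_add_two _ _ _ (by omega),
      ins_add_two _ _ _ (by omega), this]

theorem Compresses.cup_of_not_kept (hc : Compatible kept t k' .cup i)
    (hxy : Compresses kept t (i + k') x y) (hk : ¬ kept (t + 1) i) (u v : Bool) :
    Compresses kept (t + 1) (i + 2 + k') (ins i u v x) y := by
  classical
  have h0 := hc.keptCount_left le_rfl
  have h1 := keptCount_succ kept (t + 1) i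
  have h2 := keptCount_succ kept (t + 1) (i + 1)
  rw [if_neg hk, h0] at h1
  rw [if_neg ((hc.cup rfl).not.1 hk), h1] at h2
  intro j hj hkj
  rcases lt_or_ge j i with h | h
  · have hkj' := (hc.left j h).2 hkj
    rw [hc.keptCount_left h.le, ins_of_lt _ _ _ h, hxy j (by omega) hkj']
  obtain rfl | rfl | ⟨r, rfl⟩ : j = i ∨ j = i + 1 ∨ ∃ r, j = i + 2 + r := by
    rcases lt_or_ge j (i + 2) with h' | h'
    · omega
    · exact Or.inr (Or.inr ⟨j - (i + 2), by omega⟩)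
  · exact absurd hkj hk
  · exact absurd ((hc.cup rfl).2 hkj) hk
  · obtain ⟨c, e1, e2⟩ := hc.keptCount_right (show r ≤ k' by omega)
    have hkj' := (hc.right r (by omega)).2 hkj
    have := hxy _ (by simp only [Tile.bot_cup]; omega) hkj'
    simp only [Tile.top_cup, Tile.bot_cup, add_zero] at e1 e2 this
    rw [e1] at this
    rw [e2, show i + 2 = i + 1 + 1 from rfl, h2,
      show i + 1 + 1 + r = i + r + 2 by omega, ins_add_two _ _ _ (by omega), ← this, add_zero,
      add_zero]

theorem Compresses.cap_of_kept (hc : Compatible kept t k' .cap i)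
    (hxy : Compresses kept t (i + 2 + k') x y) (hk : kept t i) :
    Compresses kept (t + 1) (i + k') (del i x) (del (keptCount kept t i) y) := by
  classical
  have h0 := hc.keptCount_left le_rfl
  have h1 := keptCount_succ kept t i
  have h2 := keptCount_succ kept t (i + 1)
  rw [if_pos hk] at h1
  rw [if_pos ((hc.cap rfl).1 hk), h1] at h2
  intro j hj hkj
  rcases lt_or_ge j i with h | h
  · have hkj' := (hc.left j h).2 hkj
    rw [hc.keptCount_left h.le]
    simp only [del, h, keptCount_lt kept t h hkj', if_true]
    exact hxy j (by omega) hkj'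
  · obtain ⟨r, rfl⟩ : ∃ r, j = i + r := ⟨j - i, by omega⟩
    obtain ⟨c, e1, e2⟩ := hc.keptCount_right (show r ≤ k' by omega)
    have hkj' := (hc.right r (by omega)).2 hkj
    have := hxy _ (by simp only [Tile.bot_cap]; omega) hkj'
    simp only [Tile.top_cap, Tile.bot_cap, add_zero] at e1 e2 this
    rw [e1, show i + 2 = i + 1 + 1 from rfl, h2] at this
    rw [e2, h0]
    simp only [del]
    rw [if_neg (by omega), if_neg (by omega), show i + r + 2 = i + 1 + 1 + r by omega, ← this]
    congr 1
    omega

theorem Compresses.cap_of_not_kept (hc : Compatible kept t k' .cap i)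
    (hxy : Compresses kept t (i + 2 + k') x y) (hk : ¬ kept t i) :
    Compresses kept (t + 1) (i + k') (del i x) y := by
  classical
  have h0 := hc.keptCount_left le_rfl
  have h1 := keptCount_succ kept t i
  have h2 := keptCount_succ kept t (i + 1)
  rw [if_neg hk] at h1
  rw [if_neg ((hc.cap rfl).not.1 hk), h1] at h2
  intro j hj hkj
  rcases lt_or_ge j i with h | h
  · have hkj' := (hc.left j h).2 hkj
    rw [hc.keptCount_left h.le]
    simp only [del, h, if_true]
    exact hxy j (by omega) hkj'
  · obtain ⟨r, rfl⟩ : ∃ r, j = i + r := ⟨j - i, by omega⟩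
    obtain ⟨c, e1, e2⟩ := hc.keptCount_right (show r ≤ k' by omega)
    have hkj' := (hc.right r (by omega)).2 hkj
    have := hxy _ (by simp only [Tile.bot_cap]; omega) hkj'
    simp only [Tile.top_cap, Tile.bot_cap, add_zero] at e1 e2 this
    rw [e1, show i + 2 = i + 1 + 1 from rfl, h2] at this
    rw [e2, h0]
    simp only [del]
    rw [if_neg (by omega), show i + r + 2 = i + 1 + 1 + r by omega, ← this]
    rfl

theorem Compresses.cross_of_kept {ε : Bool} (hc : Compatible kept t k' (.cross ε) i)
    (hxy : Compresses kept t (i + 2 + k') x y) (hk : kept t i) (hk' : kept t (i + 1)) :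
    Compresses kept (t + 1) (i + 2 + k') x y := by
  classical
  have h0 := hc.keptCount_left le_rfl
  have h1 := keptCount_succ kept t i
  have h2 := keptCount_succ kept t (i + 1)
  have h3 := keptCount_succ kept (t + 1) i
  have h4 := keptCount_succ kept (t + 1) (i + 1)
  rw [if_pos hk] at h1
  rw [if_pos hk', h1] at h2
  rw [if_pos ((hc.cross_down ε rfl).1 hk'), h0] at h3
  rw [if_pos ((hc.cross_up ε rfl).1 hk), h3] at h4
  intro j hj hkj
  rcases lt_or_ge j i with h | h
  · have hkj' := (hc.left j h).2 hkj
    rw [hc.keptCount_left h.le]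
    exact hxy j (by omega) hkj'
  obtain rfl | rfl | ⟨r, rfl⟩ : j = i ∨ j = i + 1 ∨ ∃ r, j = i + 2 + r := by
    rcases lt_or_ge j (i + 2) with h' | h'
    · omega
    · exact Or.inr (Or.inr ⟨j - (i + 2), by omega⟩)
  · rw [h0]
    exact hxy j (by omega) hk
  · rw [h3, ← h1]
    exact hxy _ (by omega) hk'
  · obtain ⟨c, e1, e2⟩ := hc.keptCount_right (show r ≤ k' by omega)
    have hkj' := (hc.right r (by omega)).2 hkj
    have := hxy _ (by simp only [Tile.bot_cross]; omega) hkj'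
    simp only [Tile.top_cross, Tile.bot_cross] at e1 e2 this
    rw [e2, show i + 2 = i + 1 + 1 from rfl, h4, ← h2, ← this, e1]

theorem Compresses.cross_of_not_kept {ε : Bool} (hc : Compatible kept t k' (.cross ε) i)
    (hxy : Compresses kept t (i + 2 + k') x y) (hk : ¬ (kept t i ∧ kept t (i + 1))) :
    Compresses kept (t + 1) (i + 2 + k') (fun j => x (transp i j)) y := by
  classical
  have h0 := hc.keptCount_left le_rfl
  have h1 := keptCount_succ kept t i
  have h2 := keptCount_succ kept t (i + 1)
  have h3 := keptCount_succ kept (t + 1) i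
  have h4 := keptCount_succ kept (t + 1) (i + 1)
  have e1 := hc.cross_up ε rfl
  have e2 := hc.cross_down ε rfl
  intro j hj hkj
  beta_reduce
  rcases lt_or_ge j i with h | h
  · have hkj' := (hc.left j h).2 hkj
    rw [hc.keptCount_left h.le, transp_of_ne (by omega) (by omega)]
    exact hxy j (by omega) hkj'
  obtain rfl | rfl | ⟨r, rfl⟩ : j = i ∨ j = i + 1 ∨ ∃ r, j = i + 2 + r := by
    rcases lt_or_ge j (i + 2) with h' | h'
    · omega
    · exact Or.inr (Or.inr ⟨j - (i + 2), by omega⟩)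
  · have hk1 := e2.2 hkj
    rw [if_neg fun h => hk ⟨h, hk1⟩, add_zero] at h1
    rw [h0, ← h1, transp_left]
    exact hxy _ (by omega) hk1
  · have hk1 := e1.2 hkj
    rw [if_neg fun h => hk ⟨hk1, e2.2 h⟩, add_zero] at h3
    rw [h3, h0, transp_right]
    exact hxy _ (by omega) hk1
  · obtain ⟨c, e3, e4⟩ := hc.keptCount_right (show r ≤ k' by omega)
    have hkj' := (hc.right r (by omega)).2 hkj
    have := hxy _ (by simp only [Tile.bot_cross]; omega) hkj'
    simp only [Tile.top_cross, Tile.bot_cross] at e3 e4 this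
    have : keptCount kept (t + 1) (i + 2) = keptCount kept t (i + 2) := by
      rw [show i + 2 = i + 1 + 1 from rfl, h4, h3, h2, h1, h0]
      simp only [← e1, ← e2]
      omega
    rw [e4, this, ← e3, transp_of_ne (by omega) (by omega)]
    assumption

theorem Compresses.ins_del (hxy : Compresses kept t (i + 2 + k') x y) (hk : kept t i)
    (hk' : kept t (i + 1)) (u v : Bool) :
    Compresses kept t (i + 2 + k') (ins i u v (del i x))
      (ins (keptCount kept t i) u v (del (keptCount kept t i) y)) := by
  classical
  have h1 := keptCount_succ kept t i
  have h2 := keptCount_succ kept t (i + 1)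
  rw [if_pos hk] at h1
  rw [if_pos hk', h1] at h2
  intro j hj hkj
  rcases lt_or_ge j i with h | h
  · have h' := keptCount_lt kept t h hkj
    rw [ins_of_lt _ _ _ h, ins_of_lt _ _ _ h']
    simp only [del, h, h', if_true]
    exact hxy j (by omega) hkj
  obtain rfl | rfl | ⟨r, rfl⟩ : j = i ∨ j = i + 1 ∨ ∃ r, j = i + 2 + r := by
    rcases lt_or_ge j (i + 2) with h' | h'
    · omega
    · exact Or.inr (Or.inr ⟨j - (i + 2), by omega⟩)
  · simp
  · rw [h1, ins_succ, ins_succ]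
  · have h3 := keptCount_le kept t (show i + 1 + 1 ≤ i + 2 + r by omega)
    obtain ⟨c, hc⟩ : ∃ c, keptCount kept t (i + 2 + r) = keptCount kept t i + c + 2 :=
      ⟨keptCount kept t (i + 2 + r) - keptCount kept t i - 2, by omega⟩
    have := hxy _ hj hkj
    rw [hc] at this ⊢
    rw [show i + 2 + r = i + r + 2 by omega] at this ⊢
    rw [ins_add_two _ _ _ (by omega), ins_add_two _ _ _ (by omega)]
    simp only [del]
    rw [if_neg (by omega), if_neg (by omega), this]

theorem wordOp_eraseFrom {n n' : ℕ} {w : List Slice} (h : IsTangle n w n') (t : ℕ)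
    (hc : ∀ r i k τ, w[r]? = some ⟨τ, i⟩ → IsTangle n (w.take r) (i + τ.bot + k) →
      Compatible kept (t + r) k τ i) (x y : ℕ → Bool) (hxy : Compresses kept t n x y) :
    wordOp a b (eraseFrom kept t w) (fun _ => 1) y = keptSum a b kept t w x := by
  classical
  induction h generalizing t x y with
  | nil n => rfl
  | cons τ i k w n hw ih =>
    have hcomp := hc 0 i k τ rfl (IsTangle.nil _)
    replace ih := ih (t + 1) fun r i' k' τ' h1 h2 => by
      have := hc (r + 1) i' k' τ' (by simpa using h1)
        (by simpa using IsTangle.cons τ i k _ _ h2)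
      rwa [show t + (r + 1) = t + 1 + r by omega] at this
    rw [add_zero] at hcomp
    simp only [eraseFrom, keptSum, keptOp]
    by_cases hk : Slice.Survives kept t ⟨τ, i⟩
    · rw [if_pos hk, if_pos hk]
      cases τ with
      | cup =>
        replace hk : kept (t + 1) i := hk
        simp only [wordOp_cons, tileOp, Module.End.mul_apply, cupOp_apply]
        rw [ih _ _ (hxy.cup_of_kept hcomp hk _ _), ih _ _ (hxy.cup_of_kept hcomp hk _ _)]
      | cap =>
        replace hk : kept t i := hk
        have h1 := keptCount_succ kept t i
        rw [if_pos hk] at h1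
        simp only [wordOp_cons, tileOp, Module.End.mul_apply, capOp_apply]
        have ih' := ih (del i x) (del (keptCount kept t i) y) (hxy.cap_of_kept hcomp hk)
        rw [← ih', ← hxy i (by simp only [Tile.bot_cap]; omega) hk,
          ← hxy (i + 1) (by simp only [Tile.bot_cap]; omega) ((hcomp.cap rfl).1 hk), h1]
      | cross ε =>
        replace hk : kept t i ∧ kept t (i + 1) := hk
        have h1 := keptCount_succ kept t i
        rw [if_pos hk.1] at h1
        have hins := fun u v => (hxy.ins_del hk.1 hk.2 u v).cross_of_kept hcomp hk.1 hk.2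
        have hxy' := hxy.cross_of_kept hcomp hk.1 hk.2
        have e1 := hxy i (by simp only [Tile.bot_cross]; omega) hk.1
        have e2 := hxy (i + 1) (by simp only [Tile.bot_cross]; omega) hk.2
        rw [h1] at e2
        cases ε <;>
        simp only [wordOp_cons, tileOp, Module.End.mul_apply, LinearMap.add_apply,
          LinearMap.smul_apply, Pi.add_apply, Pi.smul_apply, capOp_apply, cupOp_apply,
          Module.End.one_apply, ih _ _ (hins _ _), ih _ _ hxy', e1, e2]
    · rw [if_neg hk, if_neg hk]
      cases τ with
      | cup => exact ih _ _ (hxy.cup_of_not_kept hcomp hk _ _)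
      | cap => exact ih _ _ (hxy.cap_of_not_kept hcomp hk)
      | cross ε => exact ih _ _ (hxy.cross_of_not_kept hcomp hk)

theorem stateSum_sublink (D : LinkDiagram) (S : Set D.Component) :
    stateSum a b (D.sublink S).1 = keptSum a b (D.Kept S) 0 D.1 fun _ => false :=
  wordOp_eraseFrom D.2 0 (fun r i k τ h1 h2 => by simpa using D.compatible S r i k τ h1 h2) _ _
    fun _ _ _ => rfl

end Sublink

/-! ### Systems of arcs

The part of a diagram above a level is a system of arcs.  The functions of the colours that arise
there are combinations of products over the arcs, with a sign for each pair of arcs that cross. -/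

section Arcs

/-- An arc with the end points `p`, `q`; it contributes `T`, a function of the colours of its ends,
if it is kept, and `c` if it is erased. -/
structure Arc (k : Type*) where
  p : ℕ
  q : ℕ
  T : Bool → Bool → k
  c : k

variable {k : Type*}

/-- The arc with renamed ends. -/
def Arc.map (σ : ℕ → ℕ) (e : Arc k) : Arc k := ⟨σ e.p, σ e.q, e.T, e.c⟩

/-- The end points of the arcs. -/
def ends (l : List (Arc k)) : List ℕ := l.flatMap fun e => [e.p, e.q]

@[simp] theorem ends_nil : ends ([] : List (Arc k)) = [] := rfl

@[simp] theorem ends_cons (e : Arc k) (l : List (Arc k)) :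
    ends (e :: l) = e.p :: e.q :: ends l := rfl

theorem mem_ends {l : List (Arc k)} {j : ℕ} : j ∈ ends l ↔ ∃ e ∈ l, j = e.p ∨ j = e.q := by
  simp [ends]

theorem ends_perm {l l' : List (Arc k)} (h : l.Perm l') : (ends l).Perm (ends l') :=
  h.flatMap_right _

theorem ends_map (σ : ℕ → ℕ) (l : List (Arc k)) : ends (l.map (Arc.map σ)) = (ends l).map σ := by
  induction l with
  | nil => rfl
  | cons e l ih => simp [ih, Arc.map]

variable [CommRing k]

/-- `1` or `-1` according to the order of two numbers. -/
def ordSign (k : Type*) [CommRing k] (p q : ℕ) : k := if p < q then 1 else -1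

theorem ordSign_comm {p q : ℕ} (h : p ≠ q) : ordSign k q p = -ordSign k p q := by
  unfold ordSign
  rcases lt_or_gt_of_ne h with h | h
  · rw [if_pos h, if_neg (by omega)]
  · rw [if_pos h, if_neg (by omega), neg_neg]

theorem ordSign_mul_self (p q : ℕ) : ordSign k p q * ordSign k p q = 1 := by
  unfold ordSign
  split_ifs <;> simp

theorem ordSign_congr {p q p' q' : ℕ} (h : p < q ↔ p' < q') : ordSign k p q = ordSign k p' q' := by
  simp [ordSign, h]

namespace Arc

/-- The arc with its ends interchanged. -/
def swap (e : Arc k) : Arc k := ⟨e.q, e.p, fun u v => -e.T v u, e.c⟩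

open Classical in
/-- The contribution of an arc. -/
noncomputable def weight (P : ℕ → Prop) (x : ℕ → Bool) (e : Arc k) : k :=
  if P e.p then ordSign k e.p e.q * e.T (x e.p) (x e.q) else e.c

open Classical in
/-- `-1` if two kept arcs cross. -/
noncomputable def crossSign (P : ℕ → Prop) (e f : Arc k) : k :=
  if P e.p ∧ P f.p then
    ordSign k e.p f.p * ordSign k e.q f.p * ordSign k e.p f.q * ordSign k e.q f.q
  else 1

/-- The deviation of an arc from a trivial one is of the first order in `y`, and its trace is of the
second order. -/
structure Admissible (y : k) (T : Bool → Bool → k) (c : k) : Prop where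
  ff : y ∣ T false false
  tt : y ∣ T true true
  ft : y ∣ T false true + c
  tf : y ∣ T true false - c
  trace : y ^ 2 ∣ T true false - T false true - 2 * c

theorem weight_swap {P : ℕ → Prop} (x : ℕ → Bool) {e : Arc k} (hP : P e.p ↔ P e.q)
    (h : e.p ≠ e.q) : e.swap.weight P x = e.weight P x := by
  simp only [weight, swap, ordSign_comm h, neg_mul_neg]
  classical exact if_congr hP.symm rfl rfl

theorem crossSign_swap_left {P : ℕ → Prop} {e : Arc k} (hP : P e.p ↔ P e.q) (f : Arc k) :
    e.swap.crossSign P f = e.crossSign P f := by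
  simp only [crossSign, swap]
  classical exact if_congr (and_congr_left' hP.symm) (by ring) rfl

theorem crossSign_comm (P : ℕ → Prop) {e f : Arc k} (h1 : e.p ≠ f.p) (h2 : e.p ≠ f.q)
    (h3 : e.q ≠ f.p) (h4 : e.q ≠ f.q) : f.crossSign P e = e.crossSign P f := by
  simp only [crossSign, ordSign_comm h1, ordSign_comm h2, ordSign_comm h3, ordSign_comm h4]
  classical exact if_congr and_comm (by ring) rfl

theorem weight_map {P P' : ℕ → Prop} {x x' : ℕ → Bool} {σ : ℕ → ℕ} {e : Arc k}
    (hP : P' (σ e.p) ↔ P e.p) (hp : x' (σ e.p) = x e.p) (hq : x' (σ e.q) = x e.q)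
    (ho : σ e.p < σ e.q ↔ e.p < e.q) : (e.map σ).weight P' x' = e.weight P x := by
  simp only [weight, map, hp, hq, ordSign_congr ho]
  classical exact if_congr hP rfl rfl

theorem crossSign_map {P P' : ℕ → Prop} {σ : ℕ → ℕ} {e f : Arc k}
    (he : P' (σ e.p) ↔ P e.p) (hf : P' (σ f.p) ↔ P f.p)
    (ho : ∀ i, i = e.p ∨ i = e.q → ∀ j, j = f.p ∨ j = f.q → (σ i < σ j ↔ i < j)) :
    (e.map σ).crossSign P' (f.map σ) = e.crossSign P f := by
  simp only [crossSign, map, ordSign_congr (ho _ (Or.inl rfl) _ (Or.inl rfl)),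
    ordSign_congr (ho _ (Or.inr rfl) _ (Or.inl rfl)),
    ordSign_congr (ho _ (Or.inl rfl) _ (Or.inr rfl)),
    ordSign_congr (ho _ (Or.inr rfl) _ (Or.inr rfl))]
  classical exact if_congr (and_congr he hf) rfl rfl

theorem crossSign_of_adjacent {P : ℕ → Prop} {e f : Arc k} (he : e.q = e.p + 1)
    (h1 : f.p ≠ e.q) (h2 : f.q ≠ e.q) :
    e.crossSign P f = 1 := by
  unfold crossSign
  split_ifs
  · rw [ordSign_congr (show e.q < f.p ↔ e.p < f.p by omega),
      ordSign_congr (show e.q < f.q ↔ e.p < f.q by omega), ordSign_mul_self, one_mul,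
      ordSign_mul_self]
  · rfl

theorem admissible_swap {y c : k} {T : Bool → Bool → k} (h : Admissible y T c) :
    Admissible y (fun u v => -T v u) c := by
  refine ⟨(dvd_neg).2 h.ff, (dvd_neg).2 h.tt, ?_, ?_, ?_⟩
  · rw [← dvd_neg]
    convert h.tf using 1
    ring
  · rw [← dvd_neg]
    convert h.ft using 1
    ring
  · convert h.trace using 1
    ring

theorem admissible_capWeight {a b y : k} (hab : a * b = 1) (hy : a + 1 = y ^ 2) :
    Admissible y (capWeight a b) 1 := by
  refine ⟨by simp [capWeight], by simp [capWeight], ⟨y, ?_⟩, ⟨-b * y, ?_⟩, ⟨-b * y ^ 2, ?_⟩⟩ <;>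
    simp only [capWeight]
  · linear_combination hy
  · linear_combination hab - b * hy
  · linear_combination hab * (a + 2) - b * (a + 1 + y ^ 2) * hy

/-- The bilinear form of the arc that arises when a minimum joins two arcs. -/
def joinForm (a b : k) (T T' : Bool → Bool → k) (u v : Bool) : k :=
  -a * (T u false * T' true v) + b * (T u true * T' false v)

theorem admissible_joinForm {a b y c c' : k} (hab : a * b = 1) (hy : a + 1 = y ^ 2)
    {T T' : Bool → Bool → k} (h : Admissible y T c) (h' : Admissible y T' c') :
    Admissible y (joinForm a b T T') (c * c') := by
  obtain ⟨⟨p, hp⟩, ⟨q, hq⟩, ⟨r, hr⟩, ⟨s, hs⟩, ⟨w, hw⟩⟩ := h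
  obtain ⟨⟨p', hp'⟩, ⟨q', hq'⟩, ⟨r', hr'⟩, ⟨s', hs'⟩, ⟨w', hw'⟩⟩ := h'
  have ha : a = y ^ 2 - 1 := by linear_combination hy
  have hb : b = b * y ^ 2 - 1 := by linear_combination b * hy - hab
  replace hr : T false true = y * r - c := by linear_combination hr
  replace hs : T true false = y * s + c := by linear_combination hs
  replace hr' : T' false true = y * r' - c' := by linear_combination hr'
  replace hs' : T' true false = y * s' + c' := by linear_combination hs'
  rw [hs, hr] at hw
  rw [hs', hr'] at hw'
  refine ⟨⟨-a * p * (y * s' + c') + b * (y * r - c) * p', ?_⟩,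
    ⟨-a * (y * s + c) * q' + b * q * (y * r' - c'), ?_⟩,
    ⟨-a * p * y * q' + b * (y * r * r' - r * c' - r' * c) + b * y * (c * c'), ?_⟩,
    ⟨-a * (y * s * s' + s * c' + s' * c) + b * y * q * p' - y * (c * c'), ?_⟩,
    ⟨s * s' + r * r' + c' * w + c * w' - (y * s + c) * (y * s' + c') + b * q * p' + a * p * q' -
      b * ((y * r - c) * (y * r' - c')), ?_⟩⟩ <;>
    simp only [joinForm, hp, hq, hr, hs, hp', hq', hr', hs']
  · ring
  · ring
  · linear_combination (c * c') * hb
  · linear_combination -(c * c') * ha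
  · linear_combination (-(y * s + c) * (y * s' + c')) * ha -
      ((y * r - c) * (y * r' - c')) * hb + c' * hw + c * hw'

theorem dvd_closing {a b y c : k} (hab : a * b = 1) (hy : a + 1 = y ^ 2)
    {T : Bool → Bool → k} (h : Admissible y T c) :
    y ^ 2 ∣ (-a * T false true + b * T true false) + 2 * c := by
  obtain ⟨-, -, -, -, ⟨w, hw⟩⟩ := h
  refine ⟨-w - T false true + b * T true false, ?_⟩
  linear_combination -hw - T false true * hy + T true false * (b * hy - hab)

/-- The bilinear form of the arc that arises when a matrix acts on the first end. -/
def actForm (y : k) (N T : Bool → Bool → k) (u v : Bool) : k :=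
  y * (N u false * T false v + N u true * T true v)

theorem admissible_actForm {y c : k} {N T : Bool → Bool → k}
    (hN : y ∣ N false false + N true true) (h : Admissible y T c) :
    Admissible y (actForm y N T) 0 := by
  refine ⟨⟨_, rfl⟩, ⟨_, rfl⟩, ⟨_, add_zero _⟩, ⟨_, sub_zero _⟩, ?_⟩
  obtain ⟨⟨p, hp⟩, ⟨q, hq⟩, ⟨r, hr⟩, ⟨s, hs⟩, -⟩ := h
  obtain ⟨n, hn⟩ := hN
  refine ⟨N true false * p - N false true * q + N true true * s - N false false * r + c * n, ?_⟩
  simp only [actForm]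
  linear_combination y * N true false * hp - y * N false true * hq + y * N true true * hs -
    y * N false false * hr + y * c * hn

end Arc

/-- The contribution of a system of arcs. -/
noncomputable def arcsWeight (P : ℕ → Prop) (x : ℕ → Bool) : List (Arc k) → k
  | [] => 1
  | e :: l => e.weight P x * (l.map (e.crossSign P)).prod * arcsWeight P x l

theorem arcsWeight_perm (P : ℕ → Prop) (x : ℕ → Bool) {l l' : List (Arc k)} (h : l.Perm l')
    (hn : (ends l).Nodup) : arcsWeight P x l = arcsWeight P x l' := by
  induction h with
  | nil => rfl
  | cons e h ih =>
    simp only [ends_cons, List.nodup_cons] at hn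
    simp only [arcsWeight, ih hn.2.2, (h.map (e.crossSign P)).prod_eq]
  | swap e f l =>
    simp only [ends_cons, List.nodup_cons, List.mem_cons, not_or] at hn
    obtain ⟨⟨h1, h2, h3, -⟩, ⟨h4, h5, -⟩, -⟩ := hn
    simp only [arcsWeight, List.map_cons, List.prod_cons,
      Arc.crossSign_comm P (Ne.symm h2) (Ne.symm h4) (Ne.symm h3) (Ne.symm h5)]
    ring
  | trans h1 h2 ih1 ih2 => rw [ih1 hn, ih2 ((ends_perm h1).nodup_iff.1 hn)]

theorem arcsWeight_swap_head {P : ℕ → Prop} (x : ℕ → Bool) {e : Arc k} (hP : P e.p ↔ P e.q)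
    (h : e.p ≠ e.q) (l : List (Arc k)) :
    arcsWeight P x (e.swap :: l) = arcsWeight P x (e :: l) := by
  simp only [arcsWeight, Arc.weight_swap x hP h, funext (Arc.crossSign_swap_left hP)]

theorem prod_crossSign_map {P P' : ℕ → Prop} {σ : ℕ → ℕ} {e : Arc k} {l : List (Arc k)}
    (he : P' (σ e.p) ↔ P e.p) (hl : ∀ j ∈ ends l, (P' (σ j) ↔ P j))
    (ho : ∀ i, i = e.p ∨ i = e.q → ∀ j ∈ ends l, (σ i < σ j ↔ i < j)) :
    ((l.map (Arc.map σ)).map ((e.map σ).crossSign P')).prod = (l.map (e.crossSign P)).prod := by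
  rw [List.map_map]
  congr 1
  refine List.map_congr_left fun f hf => ?_
  exact Arc.crossSign_map he (hl _ (mem_ends.2 ⟨f, hf, Or.inl rfl⟩))
    fun i hi j hj => ho i hi j (mem_ends.2 ⟨f, hf, hj⟩)

theorem arcsWeight_map {P P' : ℕ → Prop} {x x' : ℕ → Bool} {σ : ℕ → ℕ} {l : List (Arc k)}
    (hP : ∀ j ∈ ends l, (P' (σ j) ↔ P j)) (hx : ∀ j ∈ ends l, x' (σ j) = x j)
    (ho : ∀ i ∈ ends l, ∀ j ∈ ends l, (σ i < σ j ↔ i < j)) :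
    arcsWeight P' x' (l.map (Arc.map σ)) = arcsWeight P x l := by
  induction l with
  | nil => rfl
  | cons e l ih =>
    simp only [ends_cons, List.mem_cons] at hP hx ho
    simp only [List.map_cons, arcsWeight]
    rw [ih (fun j hj => hP j (by simp [hj])) (fun j hj => hx j (by simp [hj]))
        (fun i hi j hj => ho i (by simp [hi]) j (by simp [hj])),
      Arc.weight_map (hP _ (by simp)) (hx _ (by simp)) (hx _ (by simp)) (ho _ (by simp) _ (by simp)),
      prod_crossSign_map (hP _ (by simp)) (fun j hj => hP j (by simp [hj]))
        (fun i hi j hj => ho i (by tauto) j (by simp [hj]))]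

theorem arcsWeight_congr {P : ℕ → Prop} {x x' : ℕ → Bool} {l : List (Arc k)}
    (hx : ∀ j ∈ ends l, x' j = x j) : arcsWeight P x' l = arcsWeight P x l := by
  have := arcsWeight_map (P := P) (P' := P) (σ := id) (l := l) (fun _ _ => Iff.rfl) hx
    fun _ _ _ _ => Iff.rfl
  rwa [show l.map (Arc.map id) = l from List.map_id l] at this

end Arcs

section ArcSystem

variable {k : Type*} [CommRing k] {ι : Type*}

/-- The points of `E` at level `t` are joined to no other points at this level by the part of the
diagram above it. -/
def Isolated (w : List Slice) (t : ℕ) (E : ℕ → Prop) : Prop :=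
  ∃ Z : ℕ → ℕ → Prop, (∀ j, Z t j ↔ E j) ∧ ∀ r, t ≤ r → ∀ i k τ, w[r]? = some ⟨τ, i⟩ →
    IsTangle 0 (w.take r) (i + τ.bot + k) → Compatible Z r k τ i

/-- An arc of the part of the diagram `w` above level `t`. -/
structure IsArc (kept : ι → ℕ → ℕ → Prop) (w : List Slice) (y : k) (t : ℕ) (e : Arc k) : Prop where
  admissible : Arc.Admissible y e.T e.c
  kept_iff : ∀ S, kept S t e.p ↔ kept S t e.q
  isolated : Isolated w t fun j => j = e.p ∨ j = e.q

/-- The arcs of the part of the diagram `w` above level `t`. -/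
structure IsArcSystem (kept : ι → ℕ → ℕ → Prop) (w : List Slice) (y : k) (t n : ℕ)
    (l : List (Arc k)) : Prop where
  nodup : (ends l).Nodup
  mem : ∀ j, j ∈ ends l ↔ j < n
  isArc : ∀ e ∈ l, IsArc kept w y t e

variable {kept : ι → ℕ → ℕ → Prop} {w : List Slice} {y a b : k} {t n i k' : ℕ} {τ : Tile}
  {l : List (Arc k)}

theorem Compatible.congr {Z Z' : ℕ → ℕ → Prop} (h : Compatible Z t k' τ i)
    (h0 : ∀ j, Z' t j ↔ Z t j) (h1 : ∀ j, Z' (t + 1) j ↔ Z (t + 1) j) :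
    Compatible Z' t k' τ i := by
  constructor <;> simp only [h0, h1]
  exacts [h.left, h.right, h.cup, h.cap, h.cross_up, h.cross_down]

theorem Compatible.or {Z Z' : ℕ → ℕ → Prop} (h : Compatible Z t k' τ i)
    (h' : Compatible Z' t k' τ i) : Compatible (fun r j => Z r j ∨ Z' r j) t k' τ i :=
  ⟨fun j hj => or_congr (h.left j hj) (h'.left j hj),
    fun j hj => or_congr (h.right j hj) (h'.right j hj),
    fun e => or_congr (h.cup e) (h'.cup e), fun e => or_congr (h.cap e) (h'.cap e),
    fun ε e => or_congr (h.cross_up ε e) (h'.cross_up ε e),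
    fun ε e => or_congr (h.cross_down ε e) (h'.cross_down ε e)⟩

theorem isolated_false (w : List Slice) (t : ℕ) : Isolated w t fun _ => False :=
  ⟨fun _ _ => False, fun _ => Iff.rfl, fun _ _ _ _ _ _ _ => by constructor <;> simp⟩

theorem Isolated.or {E E' : ℕ → Prop} (h : Isolated w t E) (h' : Isolated w t E') :
    Isolated w t fun j => E j ∨ E' j := by
  obtain ⟨Z, h1, h2⟩ := h
  obtain ⟨Z', h1', h2'⟩ := h'
  exact ⟨fun r j => Z r j ∨ Z' r j, fun j => or_congr (h1 j) (h1' j),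
    fun r hr i k τ hs ht => (h2 r hr i k τ hs ht).or (h2' r hr i k τ hs ht)⟩

theorem Isolated.step (hs : w[t]? = some ⟨τ, i⟩) (ht : IsTangle 0 (w.take t) (i + τ.bot + k'))
    {E E' : ℕ → Prop} (h : Isolated w (t + 1) E)
    (hE : ∀ Z : ℕ → ℕ → Prop, (∀ j, Z t j ↔ E' j) → (∀ j, Z (t + 1) j ↔ E j) →
      Compatible Z t k' τ i) : Isolated w t E' := by
  obtain ⟨Z, h1, h2⟩ := h
  refine ⟨fun r j => if r = t then E' j else Z r j, fun j => by simp, fun r hr i' k τ' hs' ht' => ?_⟩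
  rcases hr.eq_or_lt with rfl | hr
  · rw [hs] at hs'
    obtain ⟨rfl, rfl⟩ : τ = τ' ∧ i = i' := by simpa using hs'
    obtain rfl : k' = k := by
      have := ht.eq_of_eq ht'
      omega
    exact hE _ (fun j => by simp) fun j => by simp [h1]
  · refine (h2 r hr i' k τ' hs' ht').congr (fun j => ?_) fun j => ?_
    · rw [if_neg (by omega)]
    · rw [if_neg (by omega)]

theorem IsArc.map (hs : w[t]? = some ⟨τ, i⟩) (ht : IsTangle 0 (w.take t) (i + τ.bot + k'))
    {e : Arc k} (he : IsArc kept w y (t + 1) e) (σ : ℕ → ℕ)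
    (hp : ∀ S, kept S t (σ e.p) ↔ kept S (t + 1) e.p)
    (hq : ∀ S, kept S t (σ e.q) ↔ kept S (t + 1) e.q)
    (hE : ∀ Z : ℕ → ℕ → Prop, (∀ j, Z t j ↔ j = σ e.p ∨ j = σ e.q) →
      (∀ j, Z (t + 1) j ↔ j = e.p ∨ j = e.q) → Compatible Z t k' τ i) :
    IsArc kept w y t (e.map σ) :=
  ⟨he.admissible, fun S => (hp S).trans ((he.kept_iff S).trans (hq S).symm),
    he.isolated.step hs ht hE⟩

theorem IsArc.swap {e : Arc k} (he : IsArc kept w y t e) : IsArc kept w y t e.swap :=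
  ⟨Arc.admissible_swap he.admissible, fun S => (he.kept_iff S).symm, by
    simpa only [Arc.swap, or_comm] using he.isolated⟩

theorem IsArcSystem.perm (h : IsArcSystem kept w y t n l) {l' : List (Arc k)} (hl : l.Perm l') :
    IsArcSystem kept w y t n l' ∧
      ∀ S x, arcsWeight (kept S t) x l = arcsWeight (kept S t) x l' :=
  ⟨⟨(ends_perm hl).nodup_iff.1 h.nodup, fun j => by rw [← (ends_perm hl).mem_iff, h.mem],
    fun e he => h.isArc e (hl.mem_iff.2 he)⟩, fun S x => arcsWeight_perm _ _ hl h.nodup⟩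

theorem IsArcSystem.swap {e : Arc k} (h : IsArcSystem kept w y t n (e :: l)) :
    IsArcSystem kept w y t n (e.swap :: l) ∧
      ∀ S x, arcsWeight (kept S t) x (e :: l) = arcsWeight (kept S t) x (e.swap :: l) := by
  have hperm : (ends (e.swap :: l)).Perm (ends (e :: l)) := List.Perm.swap _ _ _
  have he := h.isArc e (by simp)
  refine ⟨⟨hperm.nodup_iff.2 h.nodup, fun j => by rw [hperm.mem_iff, h.mem], fun f hf => ?_⟩,
    fun S x => (arcsWeight_swap_head x (he.kept_iff S) ?_ l).symm⟩
  · rcases List.mem_cons.1 hf with rfl | hf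
    · exact he.swap
    · exact h.isArc f (by simp [hf])
  · have := h.nodup
    simp only [ends_cons, List.nodup_cons, List.mem_cons, not_or] at this
    exact this.1.1

theorem IsArcSystem.exists_front (h : IsArcSystem kept w y t n l) {j : ℕ} (hj : j < n) :
    ∃ e l', e.p = j ∧ IsArcSystem kept w y t n (e :: l') ∧
      ∀ S x, arcsWeight (kept S t) x l = arcsWeight (kept S t) x (e :: l') := by
  obtain ⟨e, he, hj⟩ := mem_ends.1 ((h.mem j).2 hj)
  obtain ⟨l₁, l₂, rfl⟩ := List.append_of_mem he
  obtain ⟨h1, h2⟩ := h.perm (List.perm_middle (a := e) (l₁ := l₁) (l₂ := l₂))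
  rcases hj with rfl | rfl
  · exact ⟨e, _, rfl, h1, h2⟩
  · obtain ⟨h3, h4⟩ := h1.swap
    exact ⟨e.swap, _, rfl, h3, fun S x => (h2 S x).trans (h4 S x)⟩

/-- Either two points are the ends of an arc or they belong to different arcs. -/
theorem IsArcSystem.exists_pair (h : IsArcSystem kept w y t n l) {i j : ℕ} (hi : i < n) (hj : j < n)
    (hij : i ≠ j) :
    (∃ e l', e.p = i ∧ e.q = j ∧ IsArcSystem kept w y t n (e :: l') ∧
      ∀ S x, arcsWeight (kept S t) x l = arcsWeight (kept S t) x (e :: l')) ∨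
    ∃ e f l', e.q = i ∧ f.p = j ∧ IsArcSystem kept w y t n (e :: f :: l') ∧
      ∀ S x, arcsWeight (kept S t) x l = arcsWeight (kept S t) x (e :: f :: l') := by
  obtain ⟨e, l', rfl, h1, h2⟩ := h.exists_front hi
  by_cases hq : e.q = j
  · exact Or.inl ⟨e, l', rfl, hq, h1, h2⟩
  right
  have hj1 : j ∈ ends l' := by
    have := (h1.mem j).2 hj
    simp only [ends_cons, List.mem_cons] at this
    rcases this with h | h | h
    · exact absurd h.symm hij
    · exact absurd h.symm hq
    · exact h
  obtain ⟨f, hf, hj'⟩ := mem_ends.1 hj1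
  obtain ⟨l₁, l₂, rfl⟩ := List.append_of_mem hf
  obtain ⟨h3, h4⟩ := h1.swap
  obtain ⟨h5, h6⟩ := h3.perm (List.Perm.cons e.swap
    (List.perm_middle (a := f) (l₁ := l₁) (l₂ := l₂)))
  rcases hj' with rfl | rfl
  · exact ⟨e.swap, f, _, rfl, rfl, h5, fun S x => by rw [h2, h4, h6]⟩
  · obtain ⟨h7, h8⟩ := h5.perm (List.Perm.swap _ _ _)
    obtain ⟨h9, h10⟩ := h7.swap
    obtain ⟨h11, h12⟩ := h9.perm (List.Perm.swap _ _ _)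
    exact ⟨e.swap, f.swap, _, rfl, rfl, h11, fun S x => by rw [h2, h4, h6, h8, h10, h12]⟩

/-! #### A matrix acts on a strand -/

open Classical in
theorem IsArcSystem.act (h : IsArcSystem kept w y t n l) {j : ℕ} (hj : j < n) {N : Bool → Bool → k}
    (hN : y ∣ N false false + N true true) :
    ∃ l', IsArcSystem kept w y t n l' ∧ ∀ S x, arcsWeight (kept S t) x l' =
      if kept S t j then
        y * (N (x j) false * arcsWeight (kept S t) (Function.update x j false) l +
          N (x j) true * arcsWeight (kept S t) (Function.update x j true) l)
      else 0 := by
  obtain ⟨e, l', rfl, h1, h2⟩ := h.exists_front hj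
  have hnd := h1.nodup
  simp only [ends_cons, List.nodup_cons, List.mem_cons, not_or] at hnd
  have he := h1.isArc e (by simp)
  refine ⟨⟨e.p, e.q, Arc.actForm y N e.T, 0⟩ :: l', ⟨h1.nodup, h1.mem, fun f hf => ?_⟩,
    fun S x => ?_⟩
  · rcases List.mem_cons.1 hf with rfl | hf
    · exact ⟨Arc.admissible_actForm hN he.admissible, he.kept_iff, he.isolated⟩
    · exact h1.isArc f (by simp [hf])
  · have hc : ∀ u, arcsWeight (kept S t) (Function.update x e.p u) l' =
        arcsWeight (kept S t) x l' := fun u => arcsWeight_congr fun j hj => by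
      rw [Function.update_of_ne]
      rintro rfl
      exact hnd.1.2 hj
    have hcs : (⟨e.p, e.q, Arc.actForm y N e.T, 0⟩ : Arc k).crossSign (kept S t) =
        e.crossSign (kept S t) := rfl
    simp only [h2, arcsWeight, Arc.weight, hc, hcs, Function.update_self,
      Function.update_of_ne (Ne.symm hnd.1.1)]
    split_ifs
    · simp only [Arc.actForm]
      ring
    · simp

/-! #### A maximum -/

/-- The positions after two strands have been inserted. -/
def shiftUp (i p : ℕ) : ℕ := if p < i then p else p + 2

/-- The positions after two strands have been removed. -/
def shiftDown (i p : ℕ) : ℕ := if p < i then p else p - 2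

open Classical in
theorem IsArcSystem.cap (hab : a * b = 1) (hy : a + 1 = y ^ 2) (hs : w[t]? = some ⟨.cap, i⟩)
    (ht : IsTangle 0 (w.take t) (i + 2 + k')) (hc : ∀ S, Compatible (kept S) t k' .cap i)
    (h : IsArcSystem kept w y (t + 1) (i + k') l) :
    ∃ l', IsArcSystem kept w y t (i + 2 + k') l' ∧ ∀ S x, arcsWeight (kept S t) x l' =
      (if kept S t i then capWeight a b (x i) (x (i + 1)) else 1) *
        arcsWeight (kept S (t + 1)) (del i x) l := by
  have hk : ∀ j ∈ ends l, ∀ S, kept S t (shiftUp i j) ↔ kept S (t + 1) j := by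
    intro j hj S
    have hj' := (h.mem j).1 hj
    unfold shiftUp
    split_ifs with hji
    · exact (hc S).left j hji
    · obtain ⟨r, rfl⟩ : ∃ r, j = i + r := ⟨j - i, by omega⟩
      have := (hc S).right r (by omega)
      simp only [Tile.bot_cap, Tile.top_cap, add_zero] at this
      rwa [show i + r + 2 = i + 2 + r by omega]
  have hlt : ∀ p q, shiftUp i p < shiftUp i q ↔ p < q := fun p q => by
    unfold shiftUp
    split_ifs <;> omega
  have hne : ∀ p, shiftUp i p ≠ i ∧ shiftUp i p ≠ i + 1 := fun p => by
    unfold shiftUp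
    split_ifs <;> omega
  have hinj : Function.Injective (shiftUp i) := fun p q hpq => by
    have h1 := hlt p q
    have h2 := hlt q p
    omega
  refine ⟨⟨i, i + 1, capWeight a b, 1⟩ :: l.map (Arc.map (shiftUp i)), ⟨?_, ?_, ?_⟩, ?_⟩
  · simp only [ends_cons, ends_map, List.nodup_cons, List.mem_cons, List.mem_map, not_or, not_exists,
      not_and]
    exact ⟨⟨by omega, fun p _ => (hne p).1⟩, fun p _ => (hne p).2, h.nodup.map hinj⟩
  · intro j
    simp only [ends_cons, ends_map, List.mem_cons, List.mem_map, h.mem]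
    constructor
    · rintro (rfl | rfl | ⟨p, hp, rfl⟩)
      · omega
      · omega
      · unfold shiftUp
        split_ifs <;> omega
    · intro hj
      by_cases hji : j = i
      · exact Or.inl hji
      by_cases hji' : j = i + 1
      · exact Or.inr (Or.inl hji')
      refine Or.inr (Or.inr ⟨shiftDown i j, ?_, ?_⟩)
      · unfold shiftDown
        split_ifs <;> omega
      · unfold shiftUp shiftDown
        split_ifs <;> omega
  · intro f hf
    rcases List.mem_cons.1 hf with rfl | hf
    · refine ⟨Arc.admissible_capWeight hab hy, fun S => (hc S).cap rfl,
        (isolated_false w (t + 1)).step hs ht fun Z h0 h1 => ?_⟩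
      constructor <;> simp only [h0, h1, Tile.bot_cap, Tile.top_cap, reduceCtorEq] <;> intros <;>
        first | contradiction | (simp; done) | (simp; omega)
    · obtain ⟨e, he, rfl⟩ := List.mem_map.1 hf
      have hp := mem_ends.2 ⟨e, he, Or.inl rfl⟩
      have hq := mem_ends.2 ⟨e, he, Or.inr rfl⟩
      refine (h.isArc e he).map hs ht _ (hk _ hp) (hk _ hq) fun Z h0 h1 => ?_
      constructor <;> simp only [h0, h1, Tile.bot_cap, Tile.top_cap, reduceCtorEq] <;> intros <;>
        first | contradiction | (unfold shiftUp; split_ifs <;> omega)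
  · intro S x
    simp only [arcsWeight]
    rw [arcsWeight_map (P := kept S (t + 1)) (x := del i x) (fun j hj => hk j hj S) ?_
      fun p _ q _ => hlt p q, List.prod_eq_one, mul_one, Arc.weight]
    · simp [ordSign]
    · intro z hz
      simp only [List.map_map, List.mem_map, Function.comp] at hz
      obtain ⟨e, -, rfl⟩ := hz
      exact Arc.crossSign_of_adjacent rfl (hne _).2 (hne _).2
    · intro j _
      simp only [del, shiftUp]
      split_ifs <;> rfl

/-! #### A minimum -/

theorem kept_shiftDown (hc : ∀ S, Compatible (kept S) t k' .cup i) {j : ℕ} (hj : j < i + 2 + k')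
    (h1 : j ≠ i) (h2 : j ≠ i + 1) (S : ι) : kept S t (shiftDown i j) ↔ kept S (t + 1) j := by
  unfold shiftDown
  split_ifs with hji
  · exact (hc S).left j hji
  · obtain ⟨r, rfl⟩ : ∃ r, j = i + 2 + r := ⟨j - (i + 2), by omega⟩
    have := (hc S).right r (by omega)
    simp only [Tile.bot_cup, Tile.top_cup, add_zero] at this
    rwa [show i + 2 + r - 2 = i + r by omega]

theorem shiftDown_lt_iff {i p q : ℕ} (h1 : p ≠ i) (h2 : p ≠ i + 1) (h3 : q ≠ i) (h4 : q ≠ i + 1) :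
    shiftDown i p < shiftDown i q ↔ p < q := by
  unfold shiftDown
  split_ifs <;> omega

theorem ins_eq_shiftDown {i j : ℕ} (h1 : j ≠ i) (h2 : j ≠ i + 1) (u v : Bool) (x : ℕ → Bool) :
    x (shiftDown i j) = ins i u v x j := by
  simp only [shiftDown, ins, h1, h2, if_false]
  split_ifs <;> rfl

theorem nodup_shiftDown {l : List ℕ} (hn : l.Nodup) (h : ∀ p ∈ l, p ≠ i ∧ p ≠ i + 1) :
    (l.map (shiftDown i)).Nodup := by
  refine hn.map_on fun p hp q hq hpq => ?_
  have h1 := shiftDown_lt_iff (h p hp).1 (h p hp).2 (h q hq).1 (h q hq).2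
  have h2 := shiftDown_lt_iff (h q hq).1 (h q hq).2 (h p hp).1 (h p hp).2
  omega

theorem mem_shiftDown {l : List ℕ} (hl : ∀ j, j ∈ l ↔ j < i + 2 + k' ∧ j ≠ i ∧ j ≠ i + 1) (j : ℕ) :
    j ∈ l.map (shiftDown i) ↔ j < i + k' := by
  simp only [List.mem_map, hl]
  constructor
  · rintro ⟨p, hp, rfl⟩
    unfold shiftDown
    split_ifs <;> omega
  · intro hj
    refine ⟨shiftUp i j, ?_, ?_⟩
    · unfold shiftUp
      split_ifs <;> omega
    · unfold shiftUp shiftDown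
      split_ifs <;> omega

theorem IsArc.shiftDown (hs : w[t]? = some ⟨.cup, i⟩) (ht : IsTangle 0 (w.take t) (i + k'))
    (hc : ∀ S, Compatible (kept S) t k' .cup i) {e : Arc k} (he : IsArc kept w y (t + 1) e)
    (hp : e.p < i + 2 + k' ∧ e.p ≠ i ∧ e.p ≠ i + 1) (hq : e.q < i + 2 + k' ∧ e.q ≠ i ∧ e.q ≠ i + 1) :
    IsArc kept w y t (e.map (shiftDown i)) := by
  refine he.map hs ht _ (kept_shiftDown hc hp.1 hp.2.1 hp.2.2)
    (kept_shiftDown hc hq.1 hq.2.1 hq.2.2) fun Z h0 h1 => ?_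
  constructor <;> simp only [h0, h1, Tile.bot_cup, Tile.top_cup, reduceCtorEq] <;> intros <;>
    first | contradiction | (unfold Skein.shiftDown; split_ifs <;> omega) | omega

open Classical in
theorem IsArcSystem.cup_close (hs : w[t]? = some ⟨.cup, i⟩) (ht : IsTangle 0 (w.take t) (i + k'))
    (hc : ∀ S, Compatible (kept S) t k' .cup i) {e : Arc k} (hp : e.p = i) (hq : e.q = i + 1)
    (h : IsArcSystem kept w y (t + 1) (i + 2 + k') (e :: l)) :
    ∃ l', IsArcSystem kept w y t (i + k') l' ∧
      ∀ S x u v, arcsWeight (kept S (t + 1)) (ins i u v x) (e :: l) =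
        (if kept S (t + 1) i then e.T u v else e.c) * arcsWeight (kept S t) x l' := by
  have hnd := h.nodup
  simp only [ends_cons, List.nodup_cons, List.mem_cons, not_or, hp, hq] at hnd
  obtain ⟨⟨-, hi⟩, hi', hnd⟩ := hnd
  have hl : ∀ j, j ∈ ends l ↔ j < i + 2 + k' ∧ j ≠ i ∧ j ≠ i + 1 := by
    intro j
    have := h.mem j
    simp only [ends_cons, List.mem_cons, hp, hq] at this
    rw [← this]
    constructor
    · intro hj
      exact ⟨Or.inr (Or.inr hj), fun e => hi (e ▸ hj), fun e => hi' (e ▸ hj)⟩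
    · tauto
  refine ⟨l.map (Arc.map (shiftDown i)), ⟨?_, ?_, ?_⟩, ?_⟩
  · rw [ends_map]
    exact nodup_shiftDown hnd fun p hp => ((hl p).1 hp).2
  · intro j
    rw [ends_map]
    exact mem_shiftDown hl j
  · intro f hf
    obtain ⟨e, he, rfl⟩ := List.mem_map.1 hf
    exact (h.isArc e (by simp [he])).shiftDown hs ht hc ((hl _).1 (mem_ends.2 ⟨e, he, Or.inl rfl⟩))
      ((hl _).1 (mem_ends.2 ⟨e, he, Or.inr rfl⟩))
  · intro S x u v
    rw [arcsWeight_map (P := kept S (t + 1)) (x := ins i u v x)]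
    · simp only [arcsWeight]
      rw [List.prod_eq_one, mul_one, Arc.weight, hp, hq, ins_self, ins_succ]
      · simp [ordSign]
      · intro z hz
        obtain ⟨f, hf, rfl⟩ := List.mem_map.1 hz
        refine Arc.crossSign_of_adjacent (by omega) ?_ ?_
        · rw [hq]
          exact ((hl _).1 (mem_ends.2 ⟨f, hf, Or.inl rfl⟩)).2.2
        · rw [hq]
          exact ((hl _).1 (mem_ends.2 ⟨f, hf, Or.inr rfl⟩)).2.2
    · exact fun j hj => kept_shiftDown hc ((hl j).1 hj).1 ((hl j).1 hj).2.1 ((hl j).1 hj).2.2 S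
    · exact fun j hj => ins_eq_shiftDown ((hl j).1 hj).2.1 ((hl j).1 hj).2.2 u v x
    · exact fun p hp q hq => shiftDown_lt_iff ((hl p).1 hp).2.1 ((hl p).1 hp).2.2 ((hl q).1 hq).2.1
        ((hl q).1 hq).2.2

end ArcSystem

section ArcSteps

variable {k : Type*} [CommRing k] {ι : Type*}
variable {kept : ι → ℕ → ℕ → Prop} {w : List Slice} {y a b : k} {t n i k' : ℕ}
  {l : List (Arc k)}

theorem ordSign_succ_left {i r : ℕ} (h : r ≠ i + 1) : ordSign k (i + 1) r = ordSign k i r :=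
  ordSign_congr (by omega)

theorem ordSign_succ_right {i r : ℕ} (h : r ≠ i) : ordSign k r (i + 1) = ordSign k r i :=
  ordSign_congr (by omega)

open Classical in
theorem IsArcSystem.cup_join (hab : a * b = 1) (hy : a + 1 = y ^ 2) (hs : w[t]? = some ⟨.cup, i⟩)
    (ht : IsTangle 0 (w.take t) (i + k')) (hc : ∀ S, Compatible (kept S) t k' .cup i)
    {e f : Arc k} (he : e.q = i) (hf : f.p = i + 1)
    (h : IsArcSystem kept w y (t + 1) (i + 2 + k') (e :: f :: l)) :
    ∃ l', IsArcSystem kept w y t (i + k') l' ∧ ∀ S x, arcsWeight (kept S t) x l' =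
      if kept S (t + 1) i then
        -a * arcsWeight (kept S (t + 1)) (ins i false true x) (e :: f :: l) +
          b * arcsWeight (kept S (t + 1)) (ins i true false x) (e :: f :: l)
      else arcsWeight (kept S (t + 1)) (ins i false false x) (e :: f :: l) := by
  have hnd := h.nodup
  simp only [ends_cons, List.nodup_cons, List.mem_cons, not_or, he, hf] at hnd
  obtain ⟨⟨hpi, hpi', hpq, hpl⟩, ⟨-, hiq, hil⟩, ⟨hi'q, hi'l⟩, hql, hnd⟩ := hnd
  have hall : ∀ j, j = e.p ∨ j = f.q ∨ j ∈ ends l ↔ j < i + 2 + k' ∧ j ≠ i ∧ j ≠ i + 1 := by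
    intro j
    have := h.mem j
    simp only [ends_cons, List.mem_cons, he, hf] at this
    rw [← this]
    constructor
    · rintro (rfl | rfl | hj)
      · exact ⟨Or.inl rfl, hpi, hpi'⟩
      · exact ⟨by simp, Ne.symm hiq, Ne.symm hi'q⟩
      · exact ⟨by simp [hj], fun e => hil (e ▸ hj), fun e => hi'l (e ▸ hj)⟩
    · tauto
  have hp := (hall e.p).1 (by simp)
  have hq := (hall f.q).1 (by simp)
  have hl : ∀ j ∈ ends l, j < i + 2 + k' ∧ j ≠ i ∧ j ≠ i + 1 := fun j hj => (hall j).1 (by simp [hj])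
  have hse := h.isArc e (by simp)
  have hsf := h.isArc f (by simp)
  have hE : ends ((⟨shiftDown i e.p, shiftDown i f.q, Arc.joinForm a b e.T f.T, e.c * f.c⟩ : Arc k) ::
      l.map (Arc.map (shiftDown i))) = (e.p :: f.q :: ends l).map (shiftDown i) := by
    simp [ends_map]
  refine ⟨⟨shiftDown i e.p, shiftDown i f.q, Arc.joinForm a b e.T f.T, e.c * f.c⟩ ::
    l.map (Arc.map (shiftDown i)), ⟨?_, ?_, ?_⟩, ?_⟩
  · rw [hE]
    refine nodup_shiftDown ?_ fun p hp => ((hall p).1 (by simpa using hp)).2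
    simp only [List.nodup_cons, List.mem_cons, not_or]
    exact ⟨⟨hpq, hpl⟩, hql, hnd⟩
  · intro j
    rw [hE]
    exact mem_shiftDown (by simpa using hall) j
  · intro g hg
    rcases List.mem_cons.1 hg with rfl | hg
    · refine ⟨Arc.admissible_joinForm hab hy hse.admissible hsf.admissible, fun S => ?_,
        (hse.isolated.or hsf.isolated).step hs ht fun Z h0 h1 => ?_⟩
      · simp only [kept_shiftDown hc hp.1 hp.2.1 hp.2.2, kept_shiftDown hc hq.1 hq.2.1 hq.2.2]
        have h1 := hse.kept_iff S
        have h2 := hsf.kept_iff S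
        rw [he] at h1
        rw [hf] at h2
        rw [h1, ← h2]
        exact (hc S).cup rfl
      · simp only [he, hf] at h1
        constructor <;> simp only [h0, h1, Tile.bot_cup, Tile.top_cup, reduceCtorEq] <;> intros <;>
          first
          | contradiction
          | (unfold shiftDown; split_ifs <;> omega)
          | simp
    · obtain ⟨e', he', rfl⟩ := List.mem_map.1 hg
      exact (h.isArc e' (by simp [he'])).shiftDown hs ht hc (hl _ (mem_ends.2 ⟨e', he', Or.inl rfl⟩))
        (hl _ (mem_ends.2 ⟨e', he', Or.inr rfl⟩))
  · intro S x
    have hrest : ∀ u v, arcsWeight (kept S (t + 1)) (ins i u v x) l =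
        arcsWeight (kept S t) x (l.map (Arc.map (shiftDown i))) := fun u v =>
      (arcsWeight_map (fun j hj => kept_shiftDown hc (hl j hj).1 (hl j hj).2.1 (hl j hj).2.2 S)
        (fun j hj => ins_eq_shiftDown (hl j hj).2.1 (hl j hj).2.2 u v x)
        fun p hp q hq => shiftDown_lt_iff (hl p hp).2.1 (hl p hp).2.2 (hl q hq).2.1
          (hl q hq).2.2).symm
    have hkp : kept S t (shiftDown i e.p) ↔ kept S (t + 1) e.p :=
      kept_shiftDown hc hp.1 hp.2.1 hp.2.2 S
    have hke : kept S (t + 1) e.p ↔ kept S (t + 1) i := by rw [hse.kept_iff, he]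
    have hkf : kept S (t + 1) f.p ↔ kept S (t + 1) i := by rw [hf]; exact ((hc S).cup rfl).symm
    have hki : kept S (t + 1) (i + 1) ↔ kept S (t + 1) i := ((hc S).cup rfl).symm
    have hprod : ((l.map (Arc.map (shiftDown i))).map (Arc.crossSign (kept S t)
        ⟨shiftDown i e.p, shiftDown i f.q, Arc.joinForm a b e.T f.T, e.c * f.c⟩)).prod =
        (l.map (e.crossSign (kept S (t + 1)))).prod *
          (l.map (f.crossSign (kept S (t + 1)))).prod := by
      rw [← List.prod_map_mul, List.map_map]
      congr 1
      refine List.map_congr_left fun g hg => ?_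
      have hgp := hl _ (mem_ends.2 ⟨g, hg, Or.inl rfl⟩)
      have hgq := hl _ (mem_ends.2 ⟨g, hg, Or.inr rfl⟩)
      have hkg : kept S t (shiftDown i g.p) ↔ kept S (t + 1) g.p :=
        kept_shiftDown hc hgp.1 hgp.2.1 hgp.2.2 S
      simp only [Function.comp, Arc.crossSign, Arc.map, hkp, hkg, hke, hki, he, hf]
      split_ifs
      · rw [ordSign_congr (shiftDown_lt_iff hp.2.1 hp.2.2 hgp.2.1 hgp.2.2),
          ordSign_congr (shiftDown_lt_iff hp.2.1 hp.2.2 hgq.2.1 hgq.2.2),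
          ordSign_congr (shiftDown_lt_iff hq.2.1 hq.2.2 hgp.2.1 hgp.2.2),
          ordSign_congr (shiftDown_lt_iff hq.2.1 hq.2.2 hgq.2.1 hgq.2.2),
          ordSign_succ_left hgp.2.2, ordSign_succ_left hgq.2.2]
        have e1 := ordSign_mul_self (k := k) i g.p
        have e2 := ordSign_mul_self (k := k) i g.q
        linear_combination (-ordSign k e.p g.p * ordSign k e.p g.q * ordSign k f.q g.p *
          ordSign k f.q g.q) * (e1 * (ordSign k i g.q * ordSign k i g.q) + e2)
      · simp
    simp only [arcsWeight, hprod, hrest, List.map_cons, List.prod_cons, Arc.weight, hkp, hke, hkf]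
    rw [show e.crossSign (kept S (t + 1)) f = if kept S (t + 1) i then
      ordSign k e.p i * ordSign k e.p f.q * ordSign k (i + 1) f.q else 1 by
        simp only [Arc.crossSign, hke, hki, and_self, he, hf]
        rw [ordSign_succ_right hpi, ordSign_succ_left (Ne.symm hi'q),
          show ordSign k i (i + 1) = 1 by simp [ordSign], mul_one]]
    simp only [he, hf, ← ins_eq_shiftDown hp.2.1 hp.2.2, ← ins_eq_shiftDown hq.2.1 hq.2.2, ins_self,
      ins_succ, ordSign_congr (shiftDown_lt_iff hp.2.1 hp.2.2 hq.2.1 hq.2.2), Arc.joinForm]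
    split_ifs
    · have e1 := ordSign_mul_self (k := k) e.p i
      have e2 := ordSign_mul_self (k := k) (i + 1) f.q
      generalize ordSign k e.p i = o1 at *
      generalize ordSign k (i + 1) f.q = o2 at *
      generalize ordSign k e.p f.q = o3 at *
      generalize (l.map (e.crossSign (kept S (t + 1)))).prod = p1 at *
      generalize (l.map (f.crossSign (kept S (t + 1)))).prod = p2 at *
      generalize arcsWeight (kept S t) x (l.map (Arc.map (shiftDown i))) = r at *
      linear_combination (-(o3 * p1 * p2 * r * (-a * (e.T (x (shiftDown i e.p)) false *
        f.T true (x (shiftDown i f.q))) + b * (e.T (x (shiftDown i e.p)) true *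
        f.T false (x (shiftDown i f.q)))))) * (e1 * (o2 * o2) + e2)
    · ring

/-! #### A crossing -/

theorem transp_involutive (i : ℕ) : Function.Involutive (transp i) := fun j => by
  unfold transp
  split_ifs <;> omega

theorem transp_lt_iff {i p q : ℕ} (h : ¬((p = i ∨ p = i + 1) ∧ (q = i ∨ q = i + 1))) :
    transp i p < transp i q ↔ p < q := by
  unfold transp
  split_ifs <;> omega

theorem kept_transp {ε : Bool} (hc : ∀ S, Compatible (kept S) t k' (.cross ε) i) {j : ℕ}
    (hj : j < i + 2 + k') (S : ι) : kept S t (transp i j) ↔ kept S (t + 1) j := by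
  unfold transp
  split_ifs with h1 h2
  · subst h1
    exact (hc S).cross_down ε rfl
  · subst h2
    exact (hc S).cross_up ε rfl
  · rcases lt_or_ge j i with h | h
    · exact (hc S).left j h
    · obtain ⟨r, rfl⟩ : ∃ r, j = i + 2 + r := ⟨j - (i + 2), by omega⟩
      exact (hc S).right r (by omega)

open Classical in
theorem IsArcSystem.transp {ε : Bool} (hs : w[t]? = some ⟨.cross ε, i⟩)
    (ht : IsTangle 0 (w.take t) (i + 2 + k')) (hc : ∀ S, Compatible (kept S) t k' (.cross ε) i)
    (h : IsArcSystem kept w y (t + 1) (i + 2 + k') l) :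
    ∃ l', IsArcSystem kept w y t (i + 2 + k') l' ∧ ∀ S x, arcsWeight (kept S t) x l' =
      (if kept S t i ∧ kept S t (i + 1) then -1 else 1) *
        arcsWeight (kept S (t + 1)) (fun j => x (Skein.transp i j)) l := by
  have hsys : ∀ l, IsArcSystem kept w y (t + 1) (i + 2 + k') l →
      IsArcSystem kept w y t (i + 2 + k') (l.map (Arc.map (Skein.transp i))) := by
    intro l h
    refine ⟨?_, fun j => ?_, fun f hf => ?_⟩
    · rw [ends_map]
      exact h.nodup.map (transp_involutive i).injective
    · have hlt : Skein.transp i j < i + 2 + k' ↔ j < i + 2 + k' := by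
        unfold Skein.transp
        split_ifs <;> omega
      rw [ends_map, List.mem_map, ← hlt, ← h.mem]
      constructor
      · rintro ⟨p, hp, rfl⟩
        rwa [transp_involutive i p]
      · exact fun hj => ⟨_, hj, transp_involutive i j⟩
    · obtain ⟨e, he, rfl⟩ := List.mem_map.1 hf
      have hp := (h.mem _).1 (mem_ends.2 ⟨e, he, Or.inl rfl⟩)
      have hq := (h.mem _).1 (mem_ends.2 ⟨e, he, Or.inr rfl⟩)
      refine (h.isArc e he).map hs ht _ (kept_transp hc hp) (kept_transp hc hq) fun Z h0 h1 => ?_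
      constructor <;> simp only [h0, h1, Tile.bot_cross, Tile.top_cross, reduceCtorEq] <;> intros <;>
        first
        | contradiction
        | (unfold Skein.transp; split_ifs <;> omega)
  have hk : ∀ l, IsArcSystem kept w y (t + 1) (i + 2 + k') l → ∀ j ∈ ends l, ∀ S,
      (kept S t (Skein.transp i j) ↔ kept S (t + 1) j) :=
    fun l h j hj => kept_transp hc ((h.mem j).1 hj)
  have hci : ∀ S, kept S t i ↔ kept S (t + 1) (i + 1) := fun S => (hc S).cross_up ε rfl
  have hci' : ∀ S, kept S t (i + 1) ↔ kept S (t + 1) i := fun S => (hc S).cross_down ε rfl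
  rcases h.exists_pair (i := i) (j := i + 1) (by omega) (by omega) (by omega) with
    ⟨e, l', hp, hq, h1, h2⟩ | ⟨e, f, l', he, hf, h1, h2⟩
  · refine ⟨_, hsys _ h1, fun S x => ?_⟩
    have hnd := h1.nodup
    simp only [ends_cons, List.nodup_cons, List.mem_cons, not_or, hp, hq] at hnd
    obtain ⟨⟨-, hi⟩, hi', -⟩ := hnd
    have hne : ∀ j ∈ ends l', j ≠ i ∧ j ≠ i + 1 :=
      fun j hj => ⟨fun e => hi (e ▸ hj), fun e => hi' (e ▸ hj)⟩
    have hk' := hk _ h1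
    simp only [ends_cons, List.mem_cons] at hk'
    have hse := (h1.isArc e (by simp)).kept_iff S
    rw [h2]
    simp only [List.map_cons, arcsWeight]
    rw [arcsWeight_map (P := kept S (t + 1)) (x := fun j => x (Skein.transp i j))
      (fun j hj => hk' j (by simp [hj]) S) (fun _ _ => rfl)
      fun p hp q hq => transp_lt_iff fun h => (h.1.elim (hne p hp).1 (hne p hp).2),
      prod_crossSign_map (P := kept S (t + 1)) (hk' _ (by simp) S)
        (fun j hj => hk' j (by simp [hj]) S)
        fun p hp q hq => transp_lt_iff fun h => (h.2.elim (hne q hq).1 (hne q hq).2)]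
    have hw : (e.map (Skein.transp i)).weight (kept S t) x =
        (if kept S t i ∧ kept S t (i + 1) then -1 else 1) *
          e.weight (kept S (t + 1)) fun j => x (Skein.transp i j) := by
      rw [hp, hq] at hse
      simp only [Arc.weight, Arc.map, hp, hq, transp_left, transp_right, hci, hci', hse, and_self]
      split_ifs
      · simp [ordSign]
      · simp
    rw [hw]
    ring
  · refine ⟨_, hsys _ h1, fun S x => ?_⟩
    have hnd := h1.nodup
    simp only [ends_cons, List.nodup_cons, List.mem_cons, not_or, he, hf] at hnd
    obtain ⟨⟨hpi, hpi', hpq, hpl⟩, ⟨-, hiq, hil⟩, ⟨hi'q, hi'l⟩, hql, hnd⟩ := hnd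
    have hne : ∀ j ∈ ends l', j ≠ i ∧ j ≠ i + 1 :=
      fun j hj => ⟨fun e => hil (e ▸ hj), fun e => hi'l (e ▸ hj)⟩
    have hk' := hk _ h1
    simp only [ends_cons, List.mem_cons] at hk'
    have hse := (h1.isArc e (by simp)).kept_iff S
    rw [he] at hse
    rw [h2]
    simp only [List.map_cons, arcsWeight, List.prod_cons]
    rw [arcsWeight_map (P := kept S (t + 1)) (x := fun j => x (Skein.transp i j))
      (fun j hj => hk' j (by simp [hj]) S) (fun _ _ => rfl)
      fun p hp q hq => transp_lt_iff fun h => (h.1.elim (hne p hp).1 (hne p hp).2),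
      prod_crossSign_map (P := kept S (t + 1)) (hk' _ (by simp) S)
        (fun j hj => hk' j (by simp [hj]) S)
        fun p hp q hq => transp_lt_iff fun h => (h.2.elim (hne q hq).1 (hne q hq).2),
      prod_crossSign_map (P := kept S (t + 1)) (hk' _ (by simp) S)
        (fun j hj => hk' j (by simp [hj]) S)
        fun p hp q hq => transp_lt_iff fun h => (h.2.elim (hne q hq).1 (hne q hq).2),
      Arc.weight_map (P := kept S (t + 1)) (x := fun j => x (Skein.transp i j))
        (hk' _ (by simp) S) rfl rfl (transp_lt_iff (by omega)),
      Arc.weight_map (P := kept S (t + 1)) (x := fun j => x (Skein.transp i j))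
        (hk' _ (by simp) S) rfl rfl (transp_lt_iff (by omega))]
    have hw : (e.map (Skein.transp i)).crossSign (kept S t) (f.map (Skein.transp i)) =
        (if kept S t i ∧ kept S t (i + 1) then -1 else 1) *
          e.crossSign (kept S (t + 1)) f := by
      have hke : kept S t e.p ↔ kept S (t + 1) i := by
        have := hk' e.p (by simp) S
        rwa [transp_of_ne hpi hpi', hse] at this
      simp only [Arc.crossSign, Arc.map, he, hf, transp_left, transp_right, hci, hci', hse,
        transp_of_ne hpi hpi', transp_of_ne (Ne.symm hiq) (Ne.symm hi'q), hke,
        and_comm (a := kept S (t + 1) (i + 1))]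
      split_ifs
      · rw [ordSign_succ_right hpi, ordSign_succ_left (Ne.symm hi'q),
          ordSign_comm (show i ≠ i + 1 by omega)]
        ring
      · simp
    rw [hw]
    ring

end ArcSteps

section Span

variable {k : Type*} [CommRing k] {m : ℕ}

/-- The product over the finished components. -/
noncomputable def coeff (p q : Fin m → k) (S : Finset (Fin m)) : k :=
  ∏ c, if c ∈ S then p c else q c

/-- The combinations of arc systems above the level `t`; the components in `fin` lie above it. -/
noncomputable def arcSpan (kept : Finset (Fin m) → ℕ → ℕ → Prop) (w : List Slice) (y : k)
    (fin : Fin m → Prop) (t n : ℕ) : Submodule k (Finset (Fin m) → (ℕ → Bool) → k) :=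
  Submodule.span k {F | ∃ l p q, IsArcSystem kept w y t n l ∧
    (∀ c, (fin c → y ^ 2 ∣ p c + 2 * q c) ∧ (¬ fin c → p c = 1 ∧ q c = 1)) ∧
    F = fun S x => coeff p q S * arcsWeight (kept S t) x l}

variable {kept : Finset (Fin m) → ℕ → ℕ → Prop} {w : List Slice} {y a b : k} {t n i k' : ℕ}
  {fin : Fin m → Prop}

variable (a b) in
theorem keptOp_add (P : ℕ → ℕ → Prop) (t : ℕ) (s : Slice) (f g : (ℕ → Bool) → k) :
    keptOp a b P t s (f + g) = keptOp a b P t s f + keptOp a b P t s g := by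
  unfold keptOp
  split_ifs
  · exact map_add _ _ _
  · funext x
    obtain ⟨_ | _ | _, _⟩ := s <;> rfl

variable (a b) in
theorem keptOp_smul (P : ℕ → ℕ → Prop) (t : ℕ) (s : Slice) (c : k) (f : (ℕ → Bool) → k) :
    keptOp a b P t s (c • f) = c • keptOp a b P t s f := by
  unfold keptOp
  split_ifs
  · exact map_smul _ _ _
  · funext x
    obtain ⟨_ | _ | _, _⟩ := s <;> rfl

variable (a b) in
/-- The operator of a slice on families. -/
noncomputable def familyOp (kept : Finset (Fin m) → ℕ → ℕ → Prop) (t : ℕ) (s : Slice) :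
    Module.End k (Finset (Fin m) → (ℕ → Bool) → k) where
  toFun F S := keptOp a b (kept S) t s (F S)
  map_add' F G := funext fun S => keptOp_add a b (kept S) t s (F S) (G S)
  map_smul' c F := funext fun S => keptOp_smul a b (kept S) t s c (F S)

open Classical in
/-- A matrix acts on the strand `j`. -/
noncomputable def actOp (y : k) (kept : Finset (Fin m) → ℕ → ℕ → Prop) (t j : ℕ)
    (N : Bool → Bool → k) : Module.End k (Finset (Fin m) → (ℕ → Bool) → k) where
  toFun F S x := if kept S t j then
      y * (N (x j) false * F S (Function.update x j false) +
        N (x j) true * F S (Function.update x j true))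
    else 0
  map_add' F G := by
    funext S x
    simp only [Pi.add_apply]
    split_ifs
    · ring
    · simp
  map_smul' c F := by
    funext S x
    simp only [Pi.smul_apply, smul_eq_mul, RingHom.id_apply]
    split_ifs
    · ring
    · simp

open Classical in
/-- Two strands are interchanged. -/
noncomputable def transpOp (kept : Finset (Fin m) → ℕ → ℕ → Prop) (t i : ℕ) :
    Module.End k (Finset (Fin m) → (ℕ → Bool) → k) where
  toFun F S x := (if kept S t i ∧ kept S t (i + 1) then -1 else 1) * F S fun j => x (transp i j)
  map_add' F G := by
    funext S x
    simp [mul_add]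
  map_smul' c F := by
    funext S x
    simp only [Pi.smul_apply, smul_eq_mul, RingHom.id_apply]
    ring

theorem actOp_mem {j : ℕ} (hj : j < n) {N : Bool → Bool → k}
    (hN : y ∣ N false false + N true true) {F : Finset (Fin m) → (ℕ → Bool) → k}
    (hF : F ∈ arcSpan kept w y fin t n) : actOp y kept t j N F ∈ arcSpan kept w y fin t n := by
  refine (Submodule.map_span_le (actOp y kept t j N) _ _).2 ?_ (Submodule.mem_map_of_mem hF)
  rintro _ ⟨l, p, q, hl, hpq, rfl⟩
  obtain ⟨l', hl', e⟩ := hl.act hj hN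
  refine Submodule.subset_span ⟨l', p, q, hl', hpq, ?_⟩
  funext S x
  simp only [actOp, LinearMap.coe_mk, AddHom.coe_mk, e]
  split_ifs
  · ring
  · simp

theorem transpOp_mem {ε : Bool} (hs : w[t]? = some ⟨.cross ε, i⟩)
    (ht : IsTangle 0 (w.take t) (i + 2 + k')) (hc : ∀ S, Compatible (kept S) t k' (.cross ε) i)
    {F : Finset (Fin m) → (ℕ → Bool) → k} (hF : F ∈ arcSpan kept w y fin (t + 1) (i + 2 + k')) :
    transpOp kept t i F ∈ arcSpan kept w y fin t (i + 2 + k') := by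
  refine (Submodule.map_span_le (transpOp kept t i) _ _).2 ?_ (Submodule.mem_map_of_mem hF)
  rintro _ ⟨l, p, q, hl, hpq, rfl⟩
  obtain ⟨l', hl', e⟩ := hl.transp hs ht hc
  refine Submodule.subset_span ⟨l', p, q, hl', hpq, ?_⟩
  funext S x
  simp only [transpOp, LinearMap.coe_mk, AddHom.coe_mk, e]
  ring

theorem familyOp_cap_mem (hab : a * b = 1) (hy : a + 1 = y ^ 2) (hs : w[t]? = some ⟨.cap, i⟩)
    (ht : IsTangle 0 (w.take t) (i + 2 + k')) (hc : ∀ S, Compatible (kept S) t k' .cap i)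
    {F : Finset (Fin m) → (ℕ → Bool) → k} (hF : F ∈ arcSpan kept w y fin (t + 1) (i + k')) :
    familyOp a b kept t ⟨.cap, i⟩ F ∈ arcSpan kept w y fin t (i + 2 + k') := by
  refine (Submodule.map_span_le (familyOp a b kept t ⟨.cap, i⟩) _ _).2 ?_
    (Submodule.mem_map_of_mem hF)
  rintro _ ⟨l, p, q, hl, hpq, rfl⟩
  obtain ⟨l', hl', e⟩ := hl.cap hab hy hs ht hc
  refine Submodule.subset_span ⟨l', p, q, hl', hpq, ?_⟩
  funext S x
  simp only [familyOp, LinearMap.coe_mk, AddHom.coe_mk, e, keptOp]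
  by_cases hk : kept S t i
  · rw [if_pos (show Slice.Survives (kept S) t ⟨.cap, i⟩ from hk), if_pos hk]
    simp only [tileOp, capOp_apply]
    ring
  · rw [if_neg (show ¬ Slice.Survives (kept S) t ⟨.cap, i⟩ from hk), if_neg hk, one_mul]

/-! #### A crossing -/

theorem ins_del_self {u v : Bool} {x : ℕ → Bool} (hu : x i = u) (hv : x (i + 1) = v) :
    ins i u v (del i x) = x := by
  subst hu hv
  funext j
  simp only [ins, del]
  grind

theorem ins_del_transp (u v : Bool) (x : ℕ → Bool) :
    (fun j => ins i u v (del i x) (transp i j)) = ins i v u (del i x) := by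
  funext j
  simp only [ins, transp]
  grind

theorem update_update (u v : Bool) (x : ℕ → Bool) :
    Function.update (Function.update x i u) (i + 1) v = ins i u v (del i x) := by
  funext j
  simp only [ins, del, Function.update_apply]
  grind

open Classical in
theorem actOp_actOp (N N' : Bool → Bool → k) (F : Finset (Fin m) → (ℕ → Bool) → k)
    (S : Finset (Fin m)) (x : ℕ → Bool) :
    actOp y kept t i N (actOp y kept t (i + 1) N' F) S x =
      if kept S t i ∧ kept S t (i + 1) then y ^ 2 *
        (N (x i) false * (N' (x (i + 1)) false * F S (ins i false false (del i x)) +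
          N' (x (i + 1)) true * F S (ins i false true (del i x))) +
        N (x i) true * (N' (x (i + 1)) false * F S (ins i true false (del i x)) +
          N' (x (i + 1)) true * F S (ins i true true (del i x))))
      else 0 := by
  simp only [actOp, LinearMap.coe_mk, AddHom.coe_mk,
    Function.update_of_ne (show i + 1 ≠ i by omega), update_update]
  by_cases h1 : kept S t i <;> by_cases h2 : kept S t (i + 1) <;> simp only [h1, h2, if_true,
    if_false, and_true, and_false] <;> ring

/-- A scalar matrix. -/
def scalarMatrix (c : k) (u v : Bool) : k := if u = v then c else 0

/-- The diagonal matrix with entries `1` and `-1`. -/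
def signMatrix (k : Type*) [CommRing k] (u v : Bool) : k :=
  if u = v then (if u then -1 else 1) else 0

/-- An elementary matrix off the diagonal. -/
def stepMatrix (k : Type*) [CommRing k] (ε : Bool) (u v : Bool) : k :=
  if u = ε ∧ v = !ε then 1 else 0

theorem familyOp_cross_true (hab : a * b = 1) (hy : a + 1 = y ^ 2) {h : k} (hh : 2 * h = 1)
    (F : Finset (Fin m) → (ℕ → Bool) → k) :
    familyOp a b kept t ⟨.cross true, i⟩ F = transpOp kept t i F +
      (-b * h) • actOp y kept t i (scalarMatrix y) (actOp y kept t (i + 1) (scalarMatrix y)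
        (transpOp kept t i F)) +
      (-b * (a - 1) * h) • actOp y kept t i (signMatrix k) (actOp y kept t (i + 1) (signMatrix k)
        (transpOp kept t i F)) +
      (-b ^ 3 * (a - 1) * (a ^ 2 + 1)) • actOp y kept t i (stepMatrix k true)
        (actOp y kept t (i + 1) (stepMatrix k false) (transpOp kept t i F)) := by
  classical
  funext S x
  simp only [Pi.add_apply, Pi.smul_apply, smul_eq_mul, actOp_actOp]
  simp only [familyOp, transpOp, LinearMap.coe_mk, AddHom.coe_mk, keptOp]
  by_cases hk : kept S t i ∧ kept S t (i + 1)
  · rw [if_pos (show Slice.Survives (kept S) t ⟨.cross true, i⟩ from hk)]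
    simp only [if_pos hk, ins_del_transp, tileOp, LinearMap.add_apply, LinearMap.smul_apply,
      Module.End.mul_apply, Module.End.one_apply, Pi.add_apply, Pi.smul_apply, capOp_apply,
      cupOp_apply, smul_eq_mul]
    cases hu : x i <;> cases hv : x (i + 1)
    all_goals
      have e1 := congrArg (F S) (ins_del_self hu hv).symm
      have e2 := ins_del_transp (i := i) (x i) (x (i + 1)) x
      rw [ins_del_self rfl rfl, hu, hv] at e2
      rw [e2, e1]
      generalize F S (ins i false false (del i x)) = f00
      generalize F S (ins i false true (del i x)) = f01
      generalize F S (ins i true false (del i x)) = f10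
      generalize F S (ins i true true (del i x)) = f11
      simp only [capWeight, scalarMatrix, signMatrix, stepMatrix]
      simp
    · linear_combination f00 * (b * h * (y ^ 2 + a + 1) + b * (a - 1) * h) * hy - (a + 1) * f00 * (2 * h) * hab -
        (a + 1) * f00 * hh
    · linear_combination f10 * (b * h * (y ^ 2 + a + 1) - b * (a - 1) * h) * hy - b * (a + 1) * f10 * hh +
        (-a * f01 + (b - 1) * f10) * hab
    · linear_combination (f01 * (b * h * (y ^ 2 + a + 1) - b * (a - 1) * h) +
        f10 * b ^ 3 * (a - 1) * (a ^ 2 + 1)) * hy - b * (a + 1) * f01 * hh +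
        ((b - 1) * f01 - a * (a ^ 2 * b ^ 2 + a * b + 1) * f10) * hab
    · linear_combination f11 * (b * h * (y ^ 2 + a + 1) + b * (a - 1) * h) * hy - (a + 1) * f11 * (2 * h) * hab -
        (a + 1) * f11 * hh
  · rw [if_neg (show ¬ Slice.Survives (kept S) t ⟨.cross true, i⟩ from hk)]
    simp only [if_neg hk]
    ring

theorem familyOp_cross_false (hab : a * b = 1) (hy : a + 1 = y ^ 2) {h : k} (hh : 2 * h = 1)
    (F : Finset (Fin m) → (ℕ → Bool) → k) :
    familyOp a b kept t ⟨.cross false, i⟩ F = transpOp kept t i F +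
      (-b * h) • actOp y kept t i (scalarMatrix y) (actOp y kept t (i + 1) (scalarMatrix y)
        (transpOp kept t i F)) +
      (b * (a - 1) * h) • actOp y kept t i (signMatrix k) (actOp y kept t (i + 1) (signMatrix k)
        (transpOp kept t i F)) +
      (b * (a - 1) * (a ^ 2 + 1)) • actOp y kept t i (stepMatrix k false)
        (actOp y kept t (i + 1) (stepMatrix k true) (transpOp kept t i F)) := by
  classical
  funext S x
  simp only [Pi.add_apply, Pi.smul_apply, smul_eq_mul, actOp_actOp]
  simp only [familyOp, transpOp, LinearMap.coe_mk, AddHom.coe_mk, keptOp]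
  by_cases hk : kept S t i ∧ kept S t (i + 1)
  · rw [if_pos (show Slice.Survives (kept S) t ⟨.cross false, i⟩ from hk)]
    simp only [if_pos hk, ins_del_transp, tileOp, LinearMap.add_apply, LinearMap.smul_apply,
      Module.End.mul_apply, Module.End.one_apply, Pi.add_apply, Pi.smul_apply, capOp_apply,
      cupOp_apply, smul_eq_mul]
    cases hu : x i <;> cases hv : x (i + 1)
    all_goals
      have e1 := congrArg (F S) (ins_del_self hu hv).symm
      have e2 := ins_del_transp (i := i) (x i) (x (i + 1)) x
      rw [ins_del_self rfl rfl, hu, hv] at e2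
      rw [e2, e1]
      generalize F S (ins i false false (del i x)) = f00
      generalize F S (ins i false true (del i x)) = f01
      generalize F S (ins i true false (del i x)) = f10
      generalize F S (ins i true true (del i x)) = f11
      simp only [capWeight, scalarMatrix, signMatrix, stepMatrix]
      simp
    · linear_combination f00 * (b * h * (y ^ 2 + a + 1) - b * (a - 1) * h) * hy - b * (a + 1) * f00 * hh - f00 * hab
    · linear_combination (f10 * (b * h * (y ^ 2 + a + 1) + b * (a - 1) * h) -
        f01 * b * (a - 1) * (a ^ 2 + 1)) * hy - a * b * (a + 1) * f10 * hh +
        (-f10 + a ^ 3 * f01) * hab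
    · linear_combination f01 * (b * h * (y ^ 2 + a + 1) + b * (a - 1) * h) * hy - a * b * (a + 1) * f01 * hh +
        (-f01 - b * f10) * hab
    · linear_combination f11 * (b * h * (y ^ 2 + a + 1) - b * (a - 1) * h) * hy - b * (a + 1) * f11 * hh - f11 * hab
  · rw [if_neg (show ¬ Slice.Survives (kept S) t ⟨.cross false, i⟩ from hk)]
    simp only [if_neg hk]
    ring

theorem familyOp_cross_mem (hab : a * b = 1) (hy : a + 1 = y ^ 2) {h : k} (hh : 2 * h = 1) {ε : Bool}
    (hs : w[t]? = some ⟨.cross ε, i⟩) (ht : IsTangle 0 (w.take t) (i + 2 + k'))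
    (hc : ∀ S, Compatible (kept S) t k' (.cross ε) i)
    {F : Finset (Fin m) → (ℕ → Bool) → k} (hF : F ∈ arcSpan kept w y fin (t + 1) (i + 2 + k')) :
    familyOp a b kept t ⟨.cross ε, i⟩ F ∈ arcSpan kept w y fin t (i + 2 + k') := by
  have hg := transpOp_mem hs ht hc hF
  have key : ∀ N N' : Bool → Bool → k, y ∣ N false false + N true true →
      y ∣ N' false false + N' true true → ∀ c : k, c • actOp y kept t i N
        (actOp y kept t (i + 1) N' (transpOp kept t i F)) ∈ arcSpan kept w y fin t (i + 2 + k') :=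
    fun N N' hN hN' c => Submodule.smul_mem _ c
      (actOp_mem (by omega) hN (actOp_mem (by omega) hN' hg))
  have h1 : y ∣ scalarMatrix y false false + scalarMatrix y true true := by simp [scalarMatrix]
  have h2 : y ∣ signMatrix k false false + signMatrix k true true := by simp [signMatrix]
  have h3 : ∀ ε, y ∣ stepMatrix k ε false false + stepMatrix k ε true true := by
    rintro (_ | _) <;> simp [stepMatrix]
  cases ε
  · rw [familyOp_cross_false hab hy hh]
    exact add_mem (add_mem (add_mem hg (key _ _ h1 h1 _)) (key _ _ h2 h2 _))
      (key _ _ (h3 _) (h3 _) _)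
  · rw [familyOp_cross_true hab hy hh]
    exact add_mem (add_mem (add_mem hg (key _ _ h1 h1 _)) (key _ _ h2 h2 _))
      (key _ _ (h3 _) (h3 _) _)

end Span

section Cup

variable {k : Type*} [CommRing k] {m : ℕ}
  {kept : Finset (Fin m) → ℕ → ℕ → Prop} {w : List Slice} {y a b : k} {t i k' : ℕ}
  {fin₀ fin₁ : Fin m → Prop}

theorem coeff_update {p q : Fin m → k} {c : Fin m} (hp : p c = 1) (hq : q c = 1) (u v : k)
    (S : Finset (Fin m)) : coeff (Function.update p c u) (Function.update q c v) S =
      (if c ∈ S then u else v) * coeff p q S := by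
  unfold coeff
  rw [← Finset.mul_prod_erase _ _ (Finset.mem_univ c),
    ← Finset.mul_prod_erase Finset.univ (fun c => if c ∈ S then p c else q c) (Finset.mem_univ c)]
  simp only [Function.update_self, hp, hq, ite_self, one_mul]
  congr 1
  refine Finset.prod_congr rfl fun d hd => ?_
  rw [Function.update_of_ne (Finset.ne_of_mem_erase hd),
    Function.update_of_ne (Finset.ne_of_mem_erase hd)]

theorem familyOp_cup_mem (hab : a * b = 1) (hy : a + 1 = y ^ 2) (hs : w[t]? = some ⟨.cup, i⟩)
    (ht : IsTangle 0 (w.take t) (i + k')) (hc : ∀ S, Compatible (kept S) t k' .cup i)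
    (hjoin : ∀ j < i + 2 + k', j ≠ i → j ≠ i + 1 → (∀ S, kept S (t + 1) i ↔ kept S (t + 1) j) →
      ∀ c, fin₀ c ↔ fin₁ c)
    (hclose : Isolated w (t + 1) (fun j => j = i ∨ j = i + 1) →
      (∃ c, (∀ S, kept S (t + 1) i ↔ c ∈ S) ∧ ¬ fin₁ c ∧ fin₀ c ∧ ∀ d ≠ c, (fin₀ d ↔ fin₁ d)) ∨
      (∀ S, kept S (t + 1) i) ∧ ∀ c, fin₀ c ↔ fin₁ c)
    {F : Finset (Fin m) → (ℕ → Bool) → k} (hF : F ∈ arcSpan kept w y fin₁ (t + 1) (i + 2 + k')) :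
    familyOp a b kept t ⟨.cup, i⟩ F ∈ arcSpan kept w y fin₀ t (i + k') := by
  refine (Submodule.map_span_le (familyOp a b kept t ⟨.cup, i⟩) _ _).2 ?_
    (Submodule.mem_map_of_mem hF)
  rintro _ ⟨l, p, q, hl, hpq, rfl⟩
  have hval : ∀ S x, familyOp a b kept t ⟨.cup, i⟩
      (fun S x => coeff p q S * arcsWeight (kept S (t + 1)) x l) S x =
      coeff p q S * (open Classical in if kept S (t + 1) i then
        -a * arcsWeight (kept S (t + 1)) (ins i false true x) l +
          b * arcsWeight (kept S (t + 1)) (ins i true false x) l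
        else arcsWeight (kept S (t + 1)) (ins i false false x) l) := by
    intro S x
    simp only [familyOp, LinearMap.coe_mk, AddHom.coe_mk, keptOp]
    by_cases hk : kept S (t + 1) i
    · rw [if_pos (show Slice.Survives (kept S) t ⟨.cup, i⟩ from hk), if_pos hk]
      simp only [tileOp, cupOp_apply]
      ring
    · rw [if_neg (show ¬ Slice.Survives (kept S) t ⟨.cup, i⟩ from hk), if_neg hk]
  rcases hl.exists_pair (i := i) (j := i + 1) (by omega) (by omega) (by omega) with
    ⟨e, l₁, hp, hq, h1, e1⟩ | ⟨e, f, l₁, hp, hq, h1, e1⟩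
  · have he := h1.isArc e (by simp)
    obtain ⟨l', hl', e2⟩ := h1.cup_close hs ht hc hp hq
    have hval' : ∀ S x, familyOp a b kept t ⟨.cup, i⟩
        (fun S x => coeff p q S * arcsWeight (kept S (t + 1)) x l) S x =
        coeff p q S * (open Classical in if kept S (t + 1) i then
          -a * e.T false true + b * e.T true false else e.c) * arcsWeight (kept S t) x l' := by
      intro S x
      rw [hval]
      simp only [e1, e2]
      split_ifs <;> ring
    have hiso := he.isolated
    simp only [hp, hq] at hiso
    rcases hclose hiso with ⟨c, hk, hc1, hc0, hd⟩ | ⟨hk, hd⟩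
    · refine Submodule.subset_span ⟨l', Function.update p c (-a * e.T false true + b * e.T true false),
        Function.update q c e.c, hl', fun d => ?_, ?_⟩
      · by_cases hdc : d = c
        · subst hdc
          simp only [Function.update_self]
          exact ⟨fun _ => Arc.dvd_closing hab hy he.admissible, fun h => absurd hc0 h⟩
        · simp only [Function.update_of_ne hdc, hd d hdc]
          exact hpq d
      · funext S x
        rw [hval', coeff_update ((hpq c).2 hc1).1 ((hpq c).2 hc1).2]
        simp only [hk]
        split_ifs <;> ring
    · have : familyOp a b kept t ⟨.cup, i⟩
          (fun S x => coeff p q S * arcsWeight (kept S (t + 1)) x l) =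
          (-a * e.T false true + b * e.T true false) • fun S x =>
            coeff p q S * arcsWeight (kept S t) x l' := by
        funext S x
        rw [hval', if_pos (hk S)]
        simp only [Pi.smul_apply, smul_eq_mul]
        ring
      rw [this]
      refine Submodule.smul_mem _ _ (Submodule.subset_span ⟨l', p, q, hl', fun d => ?_, rfl⟩)
      rw [hd]
      exact hpq d
  · have he := h1.isArc e (by simp)
    obtain ⟨l', hl', e2⟩ := h1.cup_join hab hy hs ht hc hp hq
    have hlt := (h1.mem e.p).1 (by simp)
    have hnd := h1.nodup
    have hd := hjoin e.p hlt (by rintro h; simp [h, hp] at hnd) (by rintro h; simp [h, hq] at hnd)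
      fun S => by rw [← hp]; exact (he.kept_iff S).symm
    refine Submodule.subset_span ⟨l', p, q, hl', fun d => ?_, ?_⟩
    · rw [hd]
      exact hpq d
    · funext S x
      rw [hval, e2]
      simp only [e1]

end Cup

/-! ### The components of a diagram -/

theorem Joined.iff_of_compatible {w : List Slice} {Z : ℕ → ℕ → Prop}
    (hw : ∀ r i τ, w[r]? = some ⟨τ, i⟩ → ∃ k, IsTangle 0 (w.take r) (i + τ.bot + k))
    (hZ : ∀ r i k τ, w[r]? = some ⟨τ, i⟩ → IsTangle 0 (w.take r) (i + τ.bot + k) →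
      Compatible Z r k τ i) {p q : ℕ × ℕ} (hp : IsPoint w p) (h : Joined w p q) :
    Z p.1 p.2 ↔ Z q.1 q.2 := by
  cases h with
  | left t j s hs hj =>
    obtain ⟨k, hk⟩ := hw _ _ _ hs
    exact (hZ _ _ _ _ hs hk).left j hj
  | right t j s hs =>
    obtain ⟨k, hk⟩ := hw _ _ _ hs
    obtain ⟨-, n, hn, hj⟩ := hp
    have := hn.eq_of_eq hk
    exact (hZ _ _ _ _ hs hk).right j (by dsimp only at hj; omega)
  | cup t i hs =>
    obtain ⟨k, hk⟩ := hw _ _ _ hs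
    exact (hZ _ _ _ _ hs hk).cup rfl
  | cap t i hs =>
    obtain ⟨k, hk⟩ := hw _ _ _ hs
    exact (hZ _ _ _ _ hs hk).cap rfl
  | cross_up t i ε hs =>
    obtain ⟨k, hk⟩ := hw _ _ _ hs
    exact (hZ _ _ _ _ hs hk).cross_up ε rfl
  | cross_down t i ε hs =>
    obtain ⟨k, hk⟩ := hw _ _ _ hs
    exact (hZ _ _ _ _ hs hk).cross_down ε rfl

namespace LinkDiagram

variable (D : LinkDiagram)

theorem exists_isTangle {r i : ℕ} {τ : Tile} (hs : D.1[r]? = some ⟨τ, i⟩) :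
    ∃ k, IsTangle 0 (D.1.take r) (i + τ.bot + k) := by
  obtain ⟨hr, he⟩ := List.getElem?_eq_some_iff.1 hs
  have h := D.2
  rw [← List.take_append_drop r D.1, List.drop_eq_getElem_cons hr, he, isTangle_append_iff] at h
  obtain ⟨n, h1, h2⟩ := h
  obtain ⟨k, rfl, -⟩ := isTangle_cons_iff.1 h2
  exact ⟨k, h1⟩

variable {D}

/-- The component of a point. -/
def Point.component (P : D.Point) : D.Component := Quot.mk _ P

theorem kept_component (P : D.Point) (S : Set D.Component) :
    D.Kept S P.1.1 P.1.2 ↔ P.component ∈ S :=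
  ⟨fun ⟨Q, h, hS⟩ => by rwa [Subtype.ext h] at hS, fun h => ⟨P, rfl, h⟩⟩

/-- The component lies above the level `t`. -/
def Above (D : LinkDiagram) (t : ℕ) (c : D.Component) : Prop :=
  ∀ P : D.Point, P.component = c → t < P.1.1

theorem above_zero (c : D.Component) : D.Above 0 c := by
  rintro ⟨⟨t, j⟩, -, n, hn, hj⟩ -
  rcases t.eq_zero_or_pos with rfl | h
  · rw [List.take_zero, isTangle_nil_iff] at hn
    dsimp only at hj
    omega
  · exact h

theorem not_above_length (c : D.Component) : ¬ D.Above D.1.length c := fun h => by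
  obtain ⟨P, rfl⟩ := Quot.exists_rep c
  exact absurd (h P rfl) (not_lt.2 P.2.1)

theorem above_succ_iff {t : ℕ} {c : D.Component} :
    D.Above (t + 1) c ↔ D.Above t c ∧ ∀ P : D.Point, P.component = c → P.1.1 ≠ t + 1 := by
  refine ⟨fun h => ⟨fun P hP => (Nat.lt_succ_self t).trans (h P hP), fun P hP => (h P hP).ne'⟩,
    fun h P hP => ?_⟩
  have h1 := h.1 P hP
  have h2 := h.2 P hP
  omega

section Slice

variable {t i k' : ℕ} {τ : Tile}

/-- A point above a slice is joined to one below it unless it is an end of a minimum. -/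
theorem exists_component_eq (hs : D.1[t]? = some ⟨τ, i⟩) (P : D.Point) (hP : P.1.1 = t + 1)
    (hτ : τ = .cup → P.1.2 ≠ i ∧ P.1.2 ≠ i + 1) :
    ∃ Q : D.Point, Q.1.1 = t ∧ Q.component = P.component := by
  obtain ⟨k', ht⟩ := D.exists_isTangle hs
  obtain ⟨⟨t', j⟩, hpt⟩ := P
  obtain rfl : t' = t + 1 := hP
  obtain ⟨hlt, n, hn, hj⟩ := id hpt
  dsimp only at hj hτ
  obtain rfl := hn.eq_of_eq (ht.take_succ hs rfl)
  suffices ∃ j', j' < i + τ.bot + k' ∧ Joined D.1 (t, j') (t + 1, j) by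
    obtain ⟨j', hj', h⟩ := this
    exact ⟨⟨(t, j'), Nat.le_of_succ_le hlt, _, ht, hj'⟩, rfl, Quot.sound h⟩
  by_cases h1 : j < i
  · exact ⟨j, by omega, .left t j _ hs h1⟩
  by_cases h2 : i + τ.top ≤ j
  · obtain ⟨r, rfl⟩ : ∃ r, j = i + τ.top + r := ⟨j - (i + τ.top), by omega⟩
    exact ⟨i + τ.bot + r, by omega, .right t r _ hs⟩
  cases τ with
  | cup =>
    have := hτ rfl
    rw [Tile.top_cup] at h2
    omega
  | cap =>
    rw [Tile.top_cap] at h2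
    omega
  | cross ε =>
    rw [Tile.top_cross] at h2
    obtain rfl | rfl : j = i ∨ j = i + 1 := by omega
    · exact ⟨j + 1, by rw [Tile.bot_cross]; omega, .cross_down t j ε hs⟩
    · exact ⟨i, by rw [Tile.bot_cross]; omega, .cross_up t i ε hs⟩

theorem above_iff_of_ne_cup (hs : D.1[t]? = some ⟨τ, i⟩) (hτ : τ ≠ .cup) (c : D.Component) :
    D.Above t c ↔ D.Above (t + 1) c := by
  refine ⟨fun h => above_succ_iff.2 ⟨h, fun P hc hP => ?_⟩, fun h => (above_succ_iff.1 h).1⟩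
  obtain ⟨Q, hQ, e⟩ := exists_component_eq hs P hP fun h => absurd h hτ
  exact absurd (h Q (e.trans hc)) (by omega)

/-- The left end of a minimum. -/
def leftPoint (hs : D.1[t]? = some ⟨.cup, i⟩) : D.Point :=
  ⟨(t + 1, i), (List.getElem?_eq_some_iff.1 hs).1, by
    obtain ⟨k, hk⟩ := D.exists_isTangle hs
    exact ⟨_, hk.take_succ hs rfl, by rw [Tile.top_cup]; omega⟩⟩

theorem component_eq_leftPoint (hs : D.1[t]? = some ⟨.cup, i⟩) (P : D.Point)
    (hP : P.1 = (t + 1, i) ∨ P.1 = (t + 1, i + 1)) : P.component = (leftPoint hs).component := by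
  rcases hP with h | h
  · rw [show P = leftPoint hs from Subtype.ext h]
  · refine (Quot.sound ?_).symm
    rw [h]
    exact .cup t i hs

theorem above_iff_of_ne (hs : D.1[t]? = some ⟨.cup, i⟩) {c : D.Component}
    (hc : (leftPoint hs).component ≠ c) : D.Above t c ↔ D.Above (t + 1) c := by
  refine ⟨fun h => above_succ_iff.2 ⟨h, fun P hPc hP => ?_⟩, fun h => (above_succ_iff.1 h).1⟩
  obtain ⟨Q, hQ, e⟩ := exists_component_eq hs P hP fun _ => by
    constructor <;> intro hi <;> refine hc (Eq.trans ?_ hPc) <;> symm <;>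
      refine component_eq_leftPoint hs P ?_
    · exact Or.inl (Prod.ext hP hi)
    · exact Or.inr (Prod.ext hP hi)
  exact absurd (h Q (e.trans hPc)) (by omega)

theorem above_of_isolated (hs : D.1[t]? = some ⟨.cup, i⟩)
    (h : Isolated D.1 (t + 1) fun j => j = i ∨ j = i + 1) :
    D.Above t (leftPoint hs).component := by
  obtain ⟨Z, h1, h2⟩ := h
  have hZ : ∀ r i' k τ, D.1[r]? = some ⟨τ, i'⟩ → IsTangle 0 (D.1.take r) (i' + τ.bot + k) →
      Compatible (fun r j => t < r ∧ Z r j) r k τ i' := by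
    intro r i' k τ hs' ht'
    rcases lt_trichotomy t r with hr | rfl | hr
    · refine (h2 r hr i' k τ hs' ht').congr (fun j => and_iff_right hr)
        fun j => and_iff_right (hr.trans (Nat.lt_succ_self r))
    · rw [hs] at hs'
      obtain ⟨rfl, rfl⟩ : Tile.cup = τ ∧ i = i' := by simpa using hs'
      constructor <;> simp only [h1, lt_irrefl, false_and, Nat.lt_succ_self, true_and,
        Tile.bot_cup, Tile.top_cup, reduceCtorEq, false_implies, implies_true, true_implies] <;>
        intros <;> first | omega | (simp_all; done) | (simp; omega)
    · constructor <;> simp only [show ¬ t < r by omega, show ¬ t < r + 1 by omega, false_and,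
        implies_true]
  intro P hP
  have e := congrArg (Quot.lift (fun P : D.Point => t < P.1.1 ∧ Z P.1.1 P.1.2) fun P Q hPQ =>
    propext (Joined.iff_of_compatible (Z := fun r j => t < r ∧ Z r j)
      (fun _ _ _ => D.exists_isTangle) hZ P.2 hPQ)) hP
  exact ((iff_of_eq e).2 ⟨Nat.lt_succ_self t, (h1 i).2 (Or.inl rfl)⟩).1

end Slice

end LinkDiagram

section Main

variable {D : LinkDiagram} {m : ℕ} {K : Fin m → D.Component} {k : Type*} [CommRing k] {a b y : k}

/-- The points of the sublink in which the chosen components in `S` are kept. -/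
def LinkDiagram.keptChosen (D : LinkDiagram) (K : Fin m → D.Component) (S : Finset (Fin m)) :
    ℕ → ℕ → Prop :=
  D.Kept {c | ∀ i, c = K i → i ∈ S}

theorem keptChosen_iff (P : D.Point) (S : Finset (Fin m)) :
    D.keptChosen K S P.1.1 P.1.2 ↔ ∀ c, P.component = K c → c ∈ S :=
  LinkDiagram.kept_component P _

theorem component_eq_iff (P : D.Point) (c : Fin m) :
    P.component = K c ↔ ¬ D.keptChosen K (Finset.univ.erase c) P.1.1 P.1.2 := by
  simp only [keptChosen_iff, Finset.mem_erase, Finset.mem_univ, and_true, not_forall, not_not,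
    exists_prop]
  exact ⟨fun h => ⟨c, h, rfl⟩, fun ⟨_, h, e⟩ => e ▸ h⟩

theorem familyOp_keptChosen_cup_mem (hab : a * b = 1) (hy : a + 1 = y ^ 2)
    (hK : Function.Injective K) {t i k' : ℕ} (hs : D.1[t]? = some ⟨.cup, i⟩)
    (ht : IsTangle 0 (D.1.take t) (i + k')) {F : Finset (Fin m) → (ℕ → Bool) → k}
    (hF : F ∈ arcSpan (D.keptChosen K) D.1 y (fun c => D.Above (t + 1) (K c)) (t + 1)
      (i + 2 + k')) :
    familyOp a b (D.keptChosen K) t ⟨.cup, i⟩ F ∈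
      arcSpan (D.keptChosen K) D.1 y (fun c => D.Above t (K c)) t (i + k') := by
  have hlt : t + 1 ≤ D.1.length := (List.getElem?_eq_some_iff.1 hs).1
  let P₀ := LinkDiagram.leftPoint hs
  refine familyOp_cup_mem hab hy hs ht (fun S => D.compatible _ t i k' .cup hs ht) ?_ ?_ hF
  · intro j hj h1 h2 hS c
    by_cases hc : P₀.component = K c
    · let P : D.Point := ⟨(t + 1, j), hlt, _, ht.take_succ (k := k') hs rfl, hj⟩
      have hPc : P.component = K c := by
        rw [component_eq_iff] at hc ⊢
        exact fun h => hc ((hS _).2 h)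
      obtain ⟨Q, hQ, e⟩ := LinkDiagram.exists_component_eq hs P rfl fun _ => ⟨h1, h2⟩
      have hn : ¬ D.Above t (K c) := fun h => absurd (h Q (e.trans hPc)) (by omega)
      exact iff_of_false hn fun h => hn (LinkDiagram.above_succ_iff.1 h).1
    · exact LinkDiagram.above_iff_of_ne hs hc
  · intro h
    by_cases hc : ∃ c, P₀.component = K c
    · obtain ⟨c, hc⟩ := hc
      refine Or.inl ⟨c, fun S => ?_, fun h => ?_, ?_, fun d hd => ?_⟩
      · refine (keptChosen_iff P₀ S).trans ⟨fun h => h c hc, fun h d hd => ?_⟩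
        rwa [← hK (hc.symm.trans hd)]
      · exact absurd (h P₀ hc) (lt_irrefl _)
      · rw [← hc]
        exact LinkDiagram.above_of_isolated hs h
      · exact LinkDiagram.above_iff_of_ne hs fun e => hd (hK (e.symm.trans hc))
    · rw [not_exists] at hc
      exact Or.inr ⟨fun S => (keptChosen_iff P₀ S).2 fun c h => absurd h (hc c),
        fun c => LinkDiagram.above_iff_of_ne hs (hc c)⟩

theorem keptSum_mem_arcSpan (hab : a * b = 1) (hy : a + 1 = y ^ 2) {h : k} (hh : 2 * h = 1)
    (hK : Function.Injective K) {t d n : ℕ} (hd : t + d = D.1.length)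
    (hn : IsTangle 0 (D.1.take t) n) :
    (fun S => keptSum a b (D.keptChosen K S) t (D.1.drop t)) ∈
      arcSpan (D.keptChosen K) D.1 y (fun c => D.Above t (K c)) t n := by
  induction d generalizing t n with
  | zero =>
    obtain rfl : t = D.1.length := hd
    rw [List.take_length] at hn
    obtain rfl := hn.eq_of_eq D.2
    refine Submodule.subset_span ⟨[], 1, 1, ⟨by simp, by simp, by simp⟩, fun c =>
      ⟨fun h => absurd h (LinkDiagram.not_above_length _), fun _ => ⟨rfl, rfl⟩⟩, ?_⟩
    funext S x
    simp [keptSum, coeff, arcsWeight]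
  | succ d ih =>
    have hlt : t < D.1.length := by omega
    obtain ⟨⟨τ, i⟩, hs⟩ : ∃ s, D.1[t]? = some s := ⟨_, List.getElem?_eq_getElem hlt⟩
    obtain ⟨k', ht⟩ := D.exists_isTangle hs
    obtain rfl := hn.eq_of_eq ht
    have hF := ih (t := t + 1) (by omega) (ht.take_succ hs rfl)
    have hdrop : D.1.drop t = ⟨τ, i⟩ :: D.1.drop (t + 1) := by
      rw [List.drop_eq_getElem_cons hlt, (List.getElem?_eq_some_iff.1 hs).2]
    have hop : (fun S => keptSum a b (D.keptChosen K S) t (D.1.drop t)) =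
        familyOp a b (D.keptChosen K) t ⟨τ, i⟩
          fun S => keptSum a b (D.keptChosen K S) (t + 1) (D.1.drop (t + 1)) := by
      rw [hdrop]
      rfl
    rw [hop]
    have hc : ∀ S, Compatible (D.keptChosen K S) t k' τ i := fun S => D.compatible _ t i k' τ hs ht
    cases τ with
    | cup => exact familyOp_keptChosen_cup_mem hab hy hK hs ht hF
    | cap =>
      simp only [LinkDiagram.above_iff_of_ne_cup hs (Tile.noConfusion : Tile.cap ≠ .cup)]
      exact familyOp_cap_mem hab hy hs ht hc hF
    | cross ε =>
      have hne : Tile.cross ε ≠ .cup := Tile.noConfusion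
      simp only [LinkDiagram.above_iff_of_ne_cup hs hne]
      exact familyOp_cross_mem hab hy hh hs ht hc hF

theorem sum_coeff (p q : Fin m → k) :
    ∑ S : Finset (Fin m), 2 ^ (m - S.card) * coeff p q S = ∏ c, (p c + 2 * q c) := by
  rw [Finset.prod_add, Finset.powerset_univ]
  refine Finset.sum_congr rfl fun S _ => ?_
  rw [coeff, Finset.prod_ite, Finset.prod_mul_distrib, Finset.prod_const,
    Finset.card_sdiff_of_subset (Finset.subset_univ S), Finset.card_univ, Fintype.card_fin,
    Finset.filter_mem_eq_inter, Finset.univ_inter,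
    show Finset.univ.filter (fun c => c ∉ S) = Finset.univ \ S by ext; simp]
  ring

/-- The weighted sum over the sublinks, at the bottom of a diagram. -/
noncomputable def cabledFunctional (k : Type*) [CommRing k] (m : ℕ) :
    (Finset (Fin m) → (ℕ → Bool) → k) →ₗ[k] k where
  toFun F := ∑ S : Finset (Fin m), 2 ^ (m - S.card) * F S fun _ => false
  map_add' F G := by simp [mul_add, Finset.sum_add_distrib]
  map_smul' c F := by
    simp only [Pi.smul_apply, smul_eq_mul, RingHom.id_apply, Finset.mul_sum]
    exact Finset.sum_congr rfl fun S _ => by ring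

theorem dvd_cabledFunctional {kept : Finset (Fin m) → ℕ → ℕ → Prop} {w : List Slice}
    {F : Finset (Fin m) → (ℕ → Bool) → k} (hF : F ∈ arcSpan kept w y (fun _ => True) 0 0) :
    (y ^ 2) ^ m ∣ cabledFunctional k m F := by
  rw [← Ideal.mem_span_singleton]
  refine (Submodule.map_span_le (cabledFunctional k m) _ (Ideal.span {(y ^ 2) ^ m})).2 ?_
    (Submodule.mem_map_of_mem hF)
  rintro _ ⟨l, p, q, hl, hpq, rfl⟩
  have hl0 : l = [] := by
    rcases l with _ | ⟨e, l⟩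
    · rfl
    · exact absurd ((hl.mem e.p).1 (by simp)) (by omega)
  subst hl0
  have hval : cabledFunctional k m (fun S x => coeff p q S * arcsWeight (kept S 0) x []) =
      ∏ c, (p c + 2 * q c) := by
    simp only [cabledFunctional, LinearMap.coe_mk, AddHom.coe_mk, arcsWeight, mul_one, sum_coeff]
  rw [hval, Ideal.mem_span_singleton]
  have h := Finset.prod_dvd_prod_of_dvd (s := Finset.univ) (fun _ : Fin m => y ^ 2)
    (fun c => p c + 2 * q c) fun c _ => (hpq c).1 trivial
  rwa [Finset.prod_const, Finset.card_univ, Fintype.card_fin] at h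

theorem dvd_sum_stateSum (hab : a * b = 1) (hy : a + 1 = y ^ 2) {h : k} (hh : 2 * h = 1)
    (hK : Function.Injective K) :
    (a + 1) ^ m ∣ ∑ S : Finset (Fin m), 2 ^ (m - S.card) *
      stateSum a b (D.sublink {c | ∀ i, c = K i → i ∈ S}).1 := by
  have hF := keptSum_mem_arcSpan hab hy hh hK (Nat.zero_add _) (.nil 0 : IsTangle 0 (D.1.take 0) 0)
  simp only [LinkDiagram.above_zero] at hF
  have h := dvd_cabledFunctional hF
  simp only [stateSum_sublink]
  rw [hy]
  exact h

end Main

theorem algebraMap_eq_sq {R : Type*} [CommRing R] (c : R) :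
    algebraMap R (QuadraticAlgebra R c 0) c = ⟨0, 1⟩ ^ 2 := by
  rw [sq]
  apply QuadraticAlgebra.ext <;> simp

theorem A_add_one_pow_dvd_cabledSum {D : LinkDiagram} {m : ℕ} {K : Fin m → D.Component}
    (hK : Function.Injective K) : (A + 1) ^ m ∣ D.cabledSum K := by
  let φ := algebraMap ℚ[T;T⁻¹] (QuadraticAlgebra ℚ[T;T⁻¹] (A + 1) 0)
  have hab : φ A * φ Ainv = 1 := by rw [← map_mul, A_mul_Ainv, map_one]
  have hy : φ A + 1 = (⟨0, 1⟩ : QuadraticAlgebra ℚ[T;T⁻¹] (A + 1) 0) ^ 2 := by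
    rw [← map_one φ, ← map_add]
    exact algebraMap_eq_sq (A + 1)
  have hh : 2 * φ (LaurentPolynomial.C (1 / 2)) = 1 := by
    rw [← map_ofNat φ 2, ← map_mul, ← map_ofNat LaurentPolynomial.C 2, ← map_mul]
    norm_num
  have h := dvd_sum_stateSum hab hy hh hK
  rw [← QuadraticAlgebra.algebraMap_dvd_iff_dvd (a := A + 1) (b := 0)]
  convert h using 1
  · simp [φ]
  · simp only [LinkDiagram.cabledSum, map_sum, map_mul, map_pow, map_ofNat,
      kauffmanBracket_eq_stateSum]
    refine Finset.sum_congr rfl fun S _ => ?_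
    rw [← map_stateSum]
    rfl

end Skein

theorem mainTheorem6 :
    (∀ (L : Skein.FramedLink) (p : LaurentPolynomial ℚ),
      L.skein = p • Skein.skeinEmpty ↔ p = Skein.kauffmanBracket L) ∧
    ∀ (D : Skein.LinkDiagram) (m : ℕ) (K : Fin m → D.Component), Function.Injective K →
      (Skein.A + 1) ^ m ∣ D.cabledSum K := by
  refine ⟨fun L p => ?_, fun D m K hK => Skein.A_add_one_pow_dvd_cabledSum hK⟩
  rw [Skein.kauffmanBracket_eq_stateSum]
  exact Skein.skein_eq_smul_iff L p
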